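/- For every $\delta\in(0,1]$ there is $\eta_0>0$ such that for every $\eta\in(0,\eta_0]$ there is $n_0\in\mathbb{N}$ such that the following holds for all $n\ge n_0$. Let $G$ be a (simple) graph on $n$ vertices and let $\mathscr{C}$ be a $2$-factor of $G$ (that is, a spanning $2$-regular subgraph) consisting of exactly $\ell$ cycles, where $1\le \ell\le n^{1-\delta}$. Let $H_{\mathscr{C}}$ be the auxiliary graph with vertex set $E(\mathscr{C})$ in which two distinct non-incident edges $e,e'\in E(\mathscr{C})$ are adjacent if and only if $G$ has a cycle of length $4$ which contains both $e$ and $e'$ and no other edge of $\mathscr{C}$. Suppose that $e(H_{\mathscr{C}})\ge n^{2-\eta}$, and let $k$ be an integer with $\ell\le k\le n^{1-\delta}$. Then $G$ contains a $2$-factor consisting of exactly $k$ cycles. Moreover, such a $2$-factor can be obtained from $\mathscr{C}$ by a finite (possibly empty) sequence of $C_4$-switches, where a $C_4$-switch replaces a spanning subgraph $F$ of $G$ by the spanning subgraph with edge set $E(F)\mathbin{\triangle} E(D)$, for some $4$-cycle $D$ of $G$ exactly two of whose edges lie in $F$, these two edges being non-incident. -/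

import Mathlib

open scoped symmDiff

/-- `F` is a 2-factor of `G`: a spanning 2-regular subgraph. A graph `F` on the whole vertex set
`V` with `F ≤ G` is a spanning subgraph of `G`. -/
def IsTwoFactor {V : Type*} (G F : SimpleGraph V) : Prop :=
  F ≤ G ∧ ∀ v : V, (F.neighborSet v).ncard = 2

/-- The number of cycles of a 2-factor `F`, i.e. the number of its connected components. -/
noncomputable def numCycles {V : Type*} (F : SimpleGraph V) : ℕ :=
  Nat.card F.ConnectedComponent

/-- `D` is the edge set of a copy of `C₄` in `G`. -/
def IsC4 {V : Type*} (G : SimpleGraph V) (D : Set (Sym2 V)) : Prop :=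
  ∃ x y z w : V, x ≠ z ∧ y ≠ w ∧ G.Adj x y ∧ G.Adj y z ∧ G.Adj z w ∧ G.Adj w x ∧
    D = {s(x, y), s(y, z), s(z, w), s(w, x)}

/-- Two edges are non-incident if they have no common end-vertex. -/
def NonIncident {V : Type*} (e e' : Sym2 V) : Prop :=
  ∀ v : V, ¬ (v ∈ e ∧ v ∈ e')

/-- The copy of `C₄` in `G` with edge set `D` is implanted in `F`: exactly two of its edges lie
in `F`, and these two are non-incident. -/
def IsImplanted {V : Type*} (G F : SimpleGraph V) (D : Set (Sym2 V)) : Prop :=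
  IsC4 G D ∧ ∃ e e' : Sym2 V, NonIncident e e' ∧ D ∩ F.edgeSet = {e, e'}

/-- The auxiliary graph on `E(F)`: two distinct non-incident edges `e, e'` of `F` are adjacent if
and only if `G` has a `C₄` which contains `e` and `e'` and no other edge of `F`. -/
def auxGraph {V : Type*} (G F : SimpleGraph V) : SimpleGraph F.edgeSet where
  Adj e e' := e ≠ e' ∧ NonIncident (e : Sym2 V) (e' : Sym2 V) ∧
    ∃ D : Set (Sym2 V), IsC4 G D ∧ D ∩ F.edgeSet = {(e : Sym2 V), (e' : Sym2 V)}
  symm := ⟨fun _ _ ⟨hne, hni, D, hD, hDF⟩ =>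
    ⟨hne.symm, fun v hv => hni v hv.symm, D, hD, hDF.trans (Set.pair_comm _ _)⟩⟩
  loopless := ⟨fun _ h => h.1 rfl⟩

/-- `F'` arises from `F` by one `C₄`-switch in `G`: for some copy of `C₄` in `G` implanted in `F`,
with edge set `D`, one has `E(F') = E(F) ∆ D`. -/
def IsC4Switch {V : Type*} (G F F' : SimpleGraph V) : Prop :=
  ∃ D : Set (Sym2 V), IsImplanted G F D ∧ F'.edgeSet = F.edgeSet ∆ D

/-! Orient a 2-factor `F` along its cycles as a permutation `σ`. A 4-cycle implanted in `F` meets it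
in two arcs, from `x` to `σ x` and from `a` to `σ a`. It is parallel if its other edges join `x` to
`σ a` and `a` to `σ x`, antiparallel if they join `x` to `a` and `σ x` to `σ a`. A parallel switch
multiplies `σ` by `swap x a`: it splits a cycle containing both arcs and merges two distinct ones.
An antiparallel switch reverses an arc of a common cycle; between distinct cycles it becomes
parallel once one of them is traversed backwards.

Suppose that no sequence of at most three switches of the types below gains a cycle. Then there are
only O(n · number of cycles) implanted 4-cycles (`card_quads_le`). A larger family of pairs `(x, a)`
contains, by repeatedly discarding extremal pairs, a long monotone chain inside two fixed cycles
(`exists_chain`), or two crossing chords of one cycle. Three parallel pairs from a suitable chain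
merge, split and split again (`improvable_of_three_pairs`). Of two crossing antiparallel chords, the
first reverses an arc and so makes the second parallel (`improvable_of_crossing`).

Each gain alters the 2-factor at no more than 12 vertices and so costs only O(n) implanted 4-cycles
(`card_quads_le_of_agreeOff`). Since n^(2-η) exceeds the required multiple of n · k, cycles can be
gained one by one until there are `k`. -/

/-! ### Cycle counts of permutations under reversal and transposition -/

section Permutations

open Equiv Equiv.Perm

variable {V : Type*}

/-- The number of cycles of a permutation, fixed points included. -/
noncomputable def cyc (σ : Perm V) : ℕ := Nat.card (Quotient (SameCycle.setoid σ))

/-- It suffices to follow `σ` one step at a time; later comparisons of cycles all reduce to checking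
single steps. -/
theorem sameCycle_of_step {σ τ : Perm V} (h : ∀ v, SameCycle τ v (σ v)) {u v : V}
    (huv : SameCycle σ u v) : SameCycle τ u v := by
  obtain ⟨i, rfl⟩ := huv
  have hpow : ∀ (m : ℕ) (w : V), SameCycle τ w ((σ ^ m) w) := by
    intro m
    induction m with
    | zero => intro w; exact SameCycle.refl _ _
    | succ m ih =>
      intro w
      rw [pow_succ', Perm.mul_apply]
      exact (ih w).trans (h _)
  cases i with
  | ofNat m => simpa using hpow m u
  | negSucc m =>
    rw [zpow_negSucc]
    have := hpow (m + 1) ((σ ^ (m + 1))⁻¹ u)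
    rw [Perm.coe_inv, Equiv.apply_symm_apply] at this
    exact this.symm

theorem cyc_eq_of_step {σ τ : Perm V} (h : ∀ v, SameCycle τ v (σ v))
    (h' : ∀ v, SameCycle σ v (τ v)) : cyc τ = cyc σ :=
  Nat.card_congr (Quotient.congr (Equiv.refl V) fun _ _ =>
    ⟨sameCycle_of_step h', sameCycle_of_step h⟩)

/-- The permutation obtained by reversing the cycle through `a`. -/
noncomputable def revCycle (σ : Perm V) (a : V) : Perm V :=
  haveI := Classical.decRel (SameCycle σ)
  -- On the cycle through `a` this is `σ` composed with its inverse twice, hence the inverse;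
  -- elsewhere the extra factor is trivial.
  σ * ((cycleOf σ a)⁻¹ * (cycleOf σ a)⁻¹)

theorem revCycle_apply_of_not {σ : Perm V} {a v : V} (h : ¬ SameCycle σ a v) :
    revCycle σ a v = σ v := by
  classical
  rw [revCycle, Perm.mul_apply, Perm.mul_apply]
  have : (cycleOf σ a)⁻¹ v = v := by
    rw [Perm.inv_eq_iff_eq, cycleOf_apply_of_not_sameCycle h]
  simp [this]

theorem revCycle_apply_of_sameCycle {σ : Perm V} {a v : V} (h : SameCycle σ a v) :
    revCycle σ a (σ v) = v := by
  classical
  rw [revCycle, Perm.mul_apply, Perm.mul_apply]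
  have h1 : (cycleOf σ a)⁻¹ (σ v) = v := by
    rw [Perm.inv_eq_iff_eq, h.cycleOf_apply]
  have h2 : (cycleOf σ a)⁻¹ v = σ.symm v := by
    rw [Perm.inv_eq_iff_eq, SameCycle.cycleOf_apply (sameCycle_symm_apply_right.2 h),
      Equiv.apply_symm_apply]
  rw [h1, h2, Equiv.apply_symm_apply]

theorem sameCycle_revCycle_step (σ : Perm V) (a v : V) : SameCycle (revCycle σ a) v (σ v) := by
  by_cases h : SameCycle σ a v
  · have := revCycle_apply_of_sameCycle h
    conv_lhs => rw [← this]
    rw [sameCycle_apply_left]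
  · rw [← revCycle_apply_of_not h, sameCycle_apply_right]

theorem sameCycle_step_revCycle (σ : Perm V) (a v : V) : SameCycle σ v (revCycle σ a v) := by
  by_cases h : SameCycle σ a v
  · obtain ⟨u, rfl⟩ := σ.surjective v
    rw [revCycle_apply_of_sameCycle (sameCycle_apply_right.1 h), sameCycle_apply_left]
  · rw [revCycle_apply_of_not h, sameCycle_apply_right]

theorem cyc_revCycle (σ : Perm V) (a : V) : cyc (revCycle σ a) = cyc σ :=
  cyc_eq_of_step (sameCycle_revCycle_step σ a) (sameCycle_step_revCycle σ a)

theorem sameCycle_revCycle {σ : Perm V} {a u v : V} :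
    SameCycle (revCycle σ a) u v ↔ SameCycle σ u v :=
  ⟨sameCycle_of_step (sameCycle_step_revCycle σ a), sameCycle_of_step (sameCycle_revCycle_step σ a)⟩

variable [DecidableEq V]

theorem mul_swap_apply_of_ne {σ : Perm V} {x a v : V} (hx : v ≠ x) (ha : v ≠ a) :
    (σ * swap x a) v = σ v := by
  rw [Perm.mul_apply, swap_apply_of_ne_of_ne hx ha]

theorem mul_swap_apply_left {σ : Perm V} {x a : V} : (σ * swap x a) x = σ a := by
  rw [Perm.mul_apply, swap_apply_left]

theorem mul_swap_apply_right {σ : Perm V} {x a : V} : (σ * swap x a) a = σ x := by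
  rw [Perm.mul_apply, swap_apply_right]

variable [Finite V]

/-- From `x` the new permutation jumps to `σ a` and then follows `σ` until the first arrival at `a`;
it cannot meet `x` before, since `x` is on another cycle. -/
theorem sameCycle_mul_swap {σ : Perm V} {x a : V} (h : ¬ SameCycle σ x a) :
    SameCycle (σ * swap x a) x a := by
  classical
  have hex : ∃ m : ℕ, (σ ^ m) (σ a) = a := by
    have : SameCycle σ (σ a) a := (sameCycle_apply_left).2 (SameCycle.refl _ _)
    obtain ⟨m, -, hm⟩ := this.exists_pow_eq'
    exact ⟨m, hm⟩
  have key : ∀ t, t ≤ Nat.find hex → SameCycle (σ * swap x a) x ((σ ^ t) (σ a)) := by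
    intro t
    induction t with
    | zero =>
      intro _
      rw [pow_zero, Perm.one_apply, ← mul_swap_apply_left (x := x)]
      exact sameCycle_apply_right.2 (SameCycle.refl _ _)
    | succ t ih =>
      intro ht
      have h1 : (σ ^ t) (σ a) ≠ a := Nat.find_min hex ht
      have h2 : (σ ^ t) (σ a) ≠ x := by
        intro h2
        apply h
        rw [← h2, sameCycle_pow_left, sameCycle_apply_left]
      rw [pow_succ', Perm.mul_apply, ← mul_swap_apply_of_ne h2 h1, sameCycle_apply_right]
      exact ih (by omega)
  simpa [Nat.find_spec hex] using key _ le_rfl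

theorem sameCycle_mul_swap_of_sameCycle {σ : Perm V} {x a : V} (h : ¬ SameCycle σ x a) {u v : V}
    (huv : SameCycle σ u v) : SameCycle (σ * swap x a) u v := by
  refine sameCycle_of_step (fun w => ?_) huv
  by_cases hx : w = x
  · subst hx
    rw [← mul_swap_apply_right (x := w) (a := a), sameCycle_apply_right]
    exact sameCycle_mul_swap h
  by_cases ha : w = a
  · subst ha
    rw [← mul_swap_apply_left (x := x) (a := w), sameCycle_apply_right]
    exact (sameCycle_mul_swap h).symm
  rw [← mul_swap_apply_of_ne hx ha, sameCycle_apply_right]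

/-- The arc from `σ x` to `a` is closed under the new permutation, which sends `a` back to `σ x`,
and it does not contain `x`. -/
theorem not_sameCycle_mul_swap {σ : Perm V} {x a : V} (h : SameCycle σ x a) (hne : x ≠ a) :
    ¬ SameCycle (σ * swap x a) a x := by
  classical
  have hex : ∃ m : ℕ, (σ ^ m) x = a := by
    obtain ⟨m, -, hm⟩ := h.exists_pow_eq'
    exact ⟨m, hm⟩
  set m := Nat.find hex with hm
  have hma : (σ ^ m) x = a := Nat.find_spec hex
  have hmin : ∀ t, t < m → (σ ^ t) x ≠ a := fun t ht => Nat.find_min hex ht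
  -- An earlier return to `x` would shorten the way to `a`, against the minimality of `m`.
  have hxmin : ∀ t, 0 < t → t < m → (σ ^ t) x ≠ x := by
    intro t ht0 htm htx
    apply hmin (m - t) (by omega)
    rw [← hma]
    conv_rhs => rw [show m = (m - t) + t by omega, pow_add, Perm.mul_apply, htx]
  have hm0 : 0 < m := by
    rcases Nat.eq_zero_or_pos m with h0 | h0
    · rw [h0] at hma; exact absurd hma hne
    · exact h0
  have step : ∀ v, (∃ t, 0 < t ∧ t ≤ m ∧ v = (σ ^ t) x) →
      ∃ t, 0 < t ∧ t ≤ m ∧ (σ * swap x a) v = (σ ^ t) x := by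
    rintro v ⟨t, ht0, htm, rfl⟩
    rcases htm.eq_or_lt with rfl | htm
    · exact ⟨1, one_pos, ht0, by rw [hma, mul_swap_apply_right, pow_one]⟩
    · refine ⟨t + 1, by omega, htm, ?_⟩
      rw [mul_swap_apply_of_ne (hxmin t ht0 htm) (hmin t htm), pow_succ', Perm.mul_apply]
  intro hs
  obtain ⟨j, -, hj⟩ := hs.exists_pow_eq'
  have all : ∀ j, ∃ t, 0 < t ∧ t ≤ m ∧ ((σ * swap x a) ^ j) a = (σ ^ t) x := by
    intro j
    induction j with
    | zero => exact ⟨m, hm0, le_rfl, by simp [hma]⟩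
    | succ j ih =>
      rw [pow_succ', Perm.mul_apply]
      exact step _ ih
  obtain ⟨t, ht0, htm, ht⟩ := all j
  rw [hj] at ht
  rcases htm.eq_or_lt with rfl | htm
  · exact hne (ht.trans hma)
  · exact hxmin t ht0 htm ht.symm

/-- Multiplication by a transposition merges two distinct cycles. -/
theorem cyc_mul_swap_of_not_sameCycle {σ : Perm V} {x a : V} (h : ¬ SameCycle σ x a) :
    cyc (σ * swap x a) + 1 = cyc σ := by
  classical
  let f : Quotient (SameCycle.setoid σ) → Quotient (SameCycle.setoid (σ * swap x a)) :=
    Quotient.map id fun u v huv => sameCycle_mul_swap_of_sameCycle h huv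
  let X : Quotient (SameCycle.setoid σ) := Quotient.mk _ x
  let A : Quotient (SameCycle.setoid σ) := Quotient.mk _ a
  -- Only the cycles of `x` and `a` can be joined to each other.
  have hback : ∀ u v, SameCycle (σ * swap x a) u v → SameCycle σ u v ∨
      ((SameCycle σ u x ∨ SameCycle σ u a) ∧ (SameCycle σ v x ∨ SameCycle σ v a)) := by
    rintro u v huv
    obtain ⟨j, -, rfl⟩ := huv.exists_pow_eq'
    clear huv
    induction j with
    | zero => left; exact SameCycle.refl _ _
    | succ j ih =>
      rw [pow_succ', Perm.mul_apply]
      set w := ((σ * swap x a) ^ j) u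
      by_cases hx : w = x
      · rw [hx] at ih ⊢
        rw [mul_swap_apply_left]
        right
        refine ⟨?_, Or.inr (sameCycle_apply_left.2 (SameCycle.refl _ _))⟩
        tauto
      by_cases ha : w = a
      · rw [ha] at ih ⊢
        rw [mul_swap_apply_right]
        right
        refine ⟨?_, Or.inl (sameCycle_apply_left.2 (SameCycle.refl _ _))⟩
        tauto
      rw [mul_swap_apply_of_ne hx ha]
      simpa [sameCycle_apply_left, sameCycle_apply_right] using ih
  -- Dropping the class of `a` makes the map of classes bijective, as that class is absorbed by the
  -- class of `x`.
  have hbij : Function.Bijective (fun q : {q : Quotient (SameCycle.setoid σ) // q ≠ A} => f q.1) := by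
    constructor
    · rintro ⟨p, hp⟩ ⟨q, hq⟩ hpq
      induction p using Quotient.inductionOn with | _ u => ?_
      induction q using Quotient.inductionOn with | _ v => ?_
      have huv : SameCycle (σ * swap x a) u v := Quotient.exact hpq
      have hu : ¬ SameCycle σ u a := fun h => hp (Quotient.sound h)
      have hv : ¬ SameCycle σ v a := fun h => hq (Quotient.sound h)
      apply Subtype.ext
      apply Quotient.sound
      show SameCycle σ u v
      rcases hback u v huv with h1 | ⟨h1, h2⟩
      · exact h1
      · exact (h1.resolve_right hu).trans (h2.resolve_right hv).symm
    · intro q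
      induction q using Quotient.inductionOn with | _ v => ?_
      by_cases hv : SameCycle σ v a
      · refine ⟨⟨X, fun hXA => h (Quotient.exact hXA)⟩, Quotient.sound ?_⟩
        exact (sameCycle_mul_swap h).trans (sameCycle_mul_swap_of_sameCycle h hv.symm)
      · exact ⟨⟨Quotient.mk _ v, fun hvA => hv (Quotient.exact hvA)⟩, rfl⟩
  have hcard := Nat.card_congr (Equiv.ofBijective _ hbij)
  have : Fintype (Quotient (SameCycle.setoid σ)) := Fintype.ofFinite _
  unfold cyc
  rw [← hcard, Nat.card_eq_fintype_card, Nat.card_eq_fintype_card, Fintype.card_subtype_compl,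
    Fintype.card_subtype_eq]
  have : 0 < Fintype.card (Quotient (SameCycle.setoid σ)) := Fintype.card_pos_iff.2 ⟨A⟩
  omega

/-- Multiplication by a transposition of two points of a cycle splits it. -/
theorem cyc_mul_swap_of_sameCycle {σ : Perm V} {x a : V} (h : SameCycle σ x a) (hne : x ≠ a) :
    cyc (σ * swap x a) = cyc σ + 1 := by
  have h1 := not_sameCycle_mul_swap h hne
  -- Splitting is merging undone: the swap is an involution.
  have h2 := cyc_mul_swap_of_not_sameCycle (fun h => h1 (SameCycle.symm h))
  rw [mul_assoc, swap_mul_self, mul_one] at h2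
  exact h2.symm

end Permutations

/-! ### Orienting 2-regular graphs -/

section Orientation

open Equiv Equiv.Perm

variable {V : Type*}

/-- The graph `F` is the undirected functional graph of `σ`. -/
def Orients (σ : Perm V) (F : SimpleGraph V) : Prop :=
  ∀ u v, F.Adj u v ↔ σ u = v ∨ σ v = u

theorem Orients.adj {σ : Perm V} {F : SimpleGraph V} (h : Orients σ F) (v : V) : F.Adj v (σ v) :=
  (h _ _).2 (Or.inl rfl)

theorem Orients.ne {σ : Perm V} {F : SimpleGraph V} (h : Orients σ F) (v : V) : σ v ≠ v :=
  (h.adj v).ne'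

theorem Orients.neighborSet {σ : Perm V} {F : SimpleGraph V} (h : Orients σ F) (v : V) :
    F.neighborSet v = {σ v, σ.symm v} := by
  ext w
  rw [SimpleGraph.mem_neighborSet, h, Set.mem_insert_iff, Set.mem_singleton_iff,
    Equiv.eq_symm_apply, eq_comm (a := σ v)]

/-- Otherwise successor and predecessor of `v` coincide and `v` has a single neighbour. -/
theorem Orients.ne_two {σ : Perm V} {F : SimpleGraph V} (h : Orients σ F)
    (hF : ∀ v, (F.neighborSet v).ncard = 2) (v : V) : σ (σ v) ≠ v := by
  intro hv
  have := hF v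
  rw [h.neighborSet, ← (Equiv.eq_symm_apply σ).2 hv, Set.pair_eq_singleton,
    Set.ncard_singleton] at this
  omega

theorem Orients.numCycles_eq {σ : Perm V} {F : SimpleGraph V} [Finite V] (h : Orients σ F) :
    numCycles F = cyc σ := by
  refine Nat.card_congr (Quot.congr (Equiv.refl V) fun u v => ⟨?_, ?_⟩)
  · rintro ⟨p⟩
    show SameCycle σ u v
    induction p with
    | nil => exact SameCycle.refl _ _
    | cons hadj _ ih =>
      refine SameCycle.trans ?_ ih
      rcases (h _ _).1 hadj with rfl | rfl
      · exact sameCycle_apply_right.2 (SameCycle.refl _ _)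
      · exact sameCycle_apply_left.2 (SameCycle.refl _ _)
  · intro (huv : SameCycle σ u v)
    obtain ⟨m, -, rfl⟩ := huv.exists_pow_eq'
    clear huv
    show F.Reachable _ _
    induction m with
    | zero => exact SimpleGraph.Reachable.refl _
    | succ m ih =>
      rw [pow_succ', Perm.mul_apply]
      exact ih.trans (h.adj _).reachable

theorem Orients.revCycle {σ : Perm V} {F : SimpleGraph V} (h : Orients σ F) (a : V) :
    Orients (revCycle σ a) F := by
  have key : ∀ u v, (_root_.revCycle σ a) u = v → σ u = v ∨ σ v = u := by
    rintro u _ rfl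
    by_cases hu : SameCycle σ a u
    · obtain ⟨w, rfl⟩ := σ.surjective u
      rw [revCycle_apply_of_sameCycle (sameCycle_apply_right.1 hu)]
      exact Or.inr rfl
    · exact Or.inl (revCycle_apply_of_not hu).symm
  have key' : ∀ u v, σ u = v → (_root_.revCycle σ a) u = v ∨ (_root_.revCycle σ a) v = u := by
    rintro u _ rfl
    by_cases hu : SameCycle σ a u
    · exact Or.inr (revCycle_apply_of_sameCycle hu)
    · exact Or.inl (revCycle_apply_of_not hu)
  intro u v
  rw [h]
  constructor
  · rintro (h1 | h1)
    · exact key' _ _ h1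
    · exact (key' _ _ h1).symm
  · rintro (h1 | h1)
    · exact key _ _ h1
    · exact (key _ _ h1).symm

/-- Every finite 2-regular graph can be oriented along its cycles. -/
theorem exists_orients [Finite V] {F : SimpleGraph V} (hF : ∀ v, (F.neighborSet v).ncard = 2) :
    ∃ σ : Perm V, Orients σ F := by
  classical
  have hother : ∀ v u, ∃ w, F.Adj v u → F.Adj v w ∧ w ≠ u ∧ ∀ z, F.Adj v z → z = u ∨ z = w := by
    intro v u
    by_cases huv : F.Adj v u
    · obtain ⟨p, q, hpq, hset⟩ := Set.ncard_eq_two.1 (hF v)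
      have hmem : ∀ z, F.Adj v z ↔ z = p ∨ z = q := fun z => by
        rw [← SimpleGraph.mem_neighborSet, hset]; rfl
      rcases (hmem u).1 huv with rfl | rfl
      · exact ⟨q, fun _ => ⟨(hmem q).2 (Or.inr rfl), hpq.symm, fun z hz => (hmem z).1 hz⟩⟩
      · exact ⟨p, fun _ => ⟨(hmem p).2 (Or.inl rfl), hpq, fun z hz => ((hmem z).1 hz).symm⟩⟩
    · exact ⟨u, fun h => absurd h huv⟩
  choose o ho using hother
  -- Darts are oriented edges; `N` advances a dart along its cycle, `R` reverses it, and `R`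
  -- conjugates `N` to its inverse.
  let D := {p : V × V // F.Adj p.1 p.2}
  let n : D → D := fun d => ⟨(d.1.2, o d.1.2 d.1.1), (ho _ _ d.2.symm).1⟩
  have hoo : ∀ {v u}, F.Adj v u → o v (o v u) = u := by
    intro v u h
    have h1 := ho v u h
    have h2 := ho v (o v u) h1.1
    exact (h2.2.2 u h |>.resolve_left h1.2.1.symm).symm
  have hninj : Function.Injective n := by
    rintro ⟨⟨u, v⟩, h⟩ ⟨⟨u', v'⟩, h'⟩ heq
    have h1 : v = v' := congrArg (fun d : D => d.1.1) heq
    subst h1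
    have h2 : o v u = o v u' := congrArg (fun d : D => d.1.2) heq
    have h3 : u = u' := (hoo h.symm).symm.trans ((congrArg (o v) h2).trans (hoo h'.symm))
    subst h3
    rfl
  let N : Perm D := Equiv.ofBijective n (Finite.injective_iff_bijective.1 hninj)
  let R : Perm D := ⟨fun d => ⟨(d.1.2, d.1.1), d.2.symm⟩, fun d => ⟨(d.1.2, d.1.1), d.2.symm⟩,
    fun _ => rfl, fun _ => rfl⟩
  have hRR : R * R = 1 := Equiv.ext fun _ => rfl
  have hNRN : N * R * N = R := by
    ext1 d
    apply Subtype.ext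
    show (_, o d.1.2 (o d.1.2 d.1.1)) = _
    rw [hoo d.2.symm]
    rfl
  have hconj : R * N * R⁻¹ = N⁻¹ := by
    rw [inv_eq_of_mul_eq_one_right hRR, eq_inv_iff_mul_eq_one,
      mul_assoc, mul_assoc, ← mul_assoc N, hNRN, hRR]
  have hpow : ∀ (m : ℤ) d, R ((N ^ m) d) = (N ^ (-m)) (R d) := by
    intro m d
    have h1 : R * N ^ m * R⁻¹ = N ^ (-m) := by rw [← conj_zpow, hconj, inv_zpow, zpow_neg]
    rw [← h1, inv_eq_of_mul_eq_one_right hRR]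
    rfl
  -- If `N ^ i` maps `d` to its reverse, look halfway: for even `i` some dart equals its own
  -- reverse, for odd `i` some dart is followed by its reverse. Both are impossible.
  have hns : ∀ d, ¬ SameCycle N d (R d) := by
    rintro d ⟨i, hi⟩
    obtain ⟨j, hj | hj⟩ := Int.even_or_odd' i
    · have h1 := hpow j d
      rw [← hi, ← Perm.mul_apply (N ^ (-j)), ← zpow_add, show -j + i = j by omega] at h1
      have h2 : ((N ^ j) d).1.2 = ((N ^ j) d).1.1 := congrArg (fun e : D => e.1.1) h1
      exact ((N ^ j) d).2.ne h2.symm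
    · have h1 := hpow j d
      rw [← hi, ← Perm.mul_apply (N ^ (-j)), ← zpow_add, show -j + i = 1 + j by omega, zpow_add,
        zpow_one, Perm.mul_apply] at h1
      have h2 : ((N ^ j) d).1.1 = o ((N ^ j) d).1.2 ((N ^ j) d).1.1 :=
        congrArg (fun e : D => e.1.2) h1
      exact (ho _ _ ((N ^ j) d).2.symm).2.1 h2.symm
  obtain ⟨m, ⟨φ⟩⟩ := Finite.exists_equiv_fin (Quotient (SameCycle.setoid N))
  let f : D → Fin m := fun d => φ (Quotient.mk _ d)
  have hfN : ∀ d, f (N d) = f d := fun d =>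
    congrArg φ (Quotient.sound (sameCycle_apply_left.2 (SameCycle.refl _ _)))
  have hfR : ∀ d, f d ≠ f (R d) := fun d h => hns d (Quotient.exact (φ.injective h))
  -- Opposite darts lie in different orbits, so comparing orbit labels selects exactly one of the
  -- two directions, consistently along each orbit.
  let T : D → Prop := fun d => f d < f (R d)
  have hTR : ∀ d, T (R d) ↔ ¬ T d := by
    intro d
    have : f (R (R d)) = f d := rfl
    show f (R d) < f (R (R d)) ↔ _
    rw [this, not_lt]
    exact ⟨le_of_lt, fun h => lt_of_le_of_ne h (hfR d).symm⟩
  have hTN : ∀ d, T (N d) ↔ T d := by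
    intro d
    have h1 : f (R (N d)) = f (R d) := by
      rw [← hfN (R (N d)), show N (R (N d)) = R d from DFunLike.congr_fun hNRN d]
    show f (N d) < f (R (N d)) ↔ _
    rw [hfN, h1]
  have hTo : ∀ v u (h : F.Adj v u), T ⟨(v, o v u), (ho _ _ h).1⟩ ↔ ¬ T ⟨(v, u), h⟩ := by
    intro v u h
    exact (hTN ⟨(u, v), h.symm⟩).trans (hTR ⟨(v, u), h⟩)
  have hex : ∀ v, ∃ u, ∃ h : F.Adj v u, T ⟨(v, u), h⟩ := by
    intro v
    obtain ⟨p, q, hpq, hset⟩ := Set.ncard_eq_two.1 (hF v)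
    have hp : F.Adj v p := by rw [← SimpleGraph.mem_neighborSet, hset]; exact Or.inl rfl
    by_cases hT : T ⟨(v, p), hp⟩
    · exact ⟨p, hp, hT⟩
    · exact ⟨_, _, (hTo v p hp).2 hT⟩
  choose s hs hsT using hex
  have huniq : ∀ v u (h : F.Adj v u), T ⟨(v, u), h⟩ → u = s v := by
    intro v u h hT
    by_contra hne
    rcases (ho v (s v) (hs v)).2.2 u h with h1 | h1
    · exact hne h1
    · subst h1
      exact (hTo v _ (hs v)).1 hT (hsT v)
  -- If `v` and `v'` had the same successor, the selected dart from `v` would continue to `v'`, so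
  -- both directions of one edge would be selected.
  have hsinj : Function.Injective s := by
    intro v v' heq
    by_contra hne
    have h1 : T ⟨(s v, o (s v) v), (ho _ _ (hs v).symm).1⟩ := (hTN ⟨(v, s v), hs v⟩).2 (hsT v)
    have hadj : F.Adj (s v) v' := heq ▸ (hs v').symm
    have h2 : o (s v) v = v' :=
      ((ho (s v) v (hs v).symm).2.2 v' hadj |>.resolve_left (Ne.symm hne)).symm
    have h3 : T ⟨(s v, v'), hadj⟩ := by
      have : ∀ w (hw : F.Adj (s v) w), w = v' → T ⟨(s v, w), hw⟩ → T ⟨(s v, v'), hadj⟩ := by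
        rintro w hw rfl h; exact h
      exact this _ _ h2 h1
    have h4 : T ⟨(v', s v), hadj.symm⟩ := by
      have : ∀ w (hw : F.Adj v' w), s v = w → T ⟨(v', w), hw⟩ → T ⟨(v', s v), hadj.symm⟩ := by
        rintro w hw rfl h; exact h
      exact this _ _ heq (hsT v')
    exact (hTR ⟨(s v, v'), hadj⟩).1 h4 h3
  refine ⟨Equiv.ofBijective s (Finite.injective_iff_bijective.1 hsinj), ?_⟩
  intro u v
  constructor
  · intro h
    by_cases hT : T ⟨(u, v), h⟩
    · exact Or.inl (huniq u v h hT).symm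
    · exact Or.inr (huniq v u h.symm ((hTR ⟨(u, v), h⟩).2 hT)).symm
  · rintro (rfl | rfl)
    · exact hs u
    · exact (hs v).symm

end Orientation

/-! ### Switching along a 4-cycle -/

section Switching

open Equiv Equiv.Perm

variable {V : Type*}

/-- At each corner of the switched 4-cycle one neighbour is exchanged for another. -/
theorem ncard_eq_two_of_exchange {A B : Set V} {p q : V} (hA : A.ncard = 2) (hq : q ∈ A)
    (hp : p ∉ A) (hB : ∀ u, u ∈ B ↔ u = p ∨ (u ∈ A ∧ u ≠ q)) : B.ncard = 2 := by
  have hB' : B = insert p (A \ {q}) := by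
    ext u
    rw [hB]
    rfl
  have hfin : A.Finite := Set.finite_of_ncard_pos (by omega)
  rw [hB', Set.ncard_insert_of_notMem (fun h => hp h.1) hfin.sdiff,
    Set.ncard_sdiff_singleton_of_mem hq, hA]

/-- Replacing the edges `xy`, `zw` of a 2-factor by the edges `yz`, `wx` of `G`. -/
theorem exists_c4Switch {G F : SimpleGraph V} (hF : IsTwoFactor G F) {x y z w : V}
    (hxz : x ≠ z) (hyw : y ≠ w) (hxy : F.Adj x y) (hzw : F.Adj z w) (hyz : G.Adj y z)
    (hwx : G.Adj w x) (nyz : ¬ F.Adj y z) (nwx : ¬ F.Adj w x) :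
    ∃ F' : SimpleGraph V, IsTwoFactor G F' ∧ IsC4Switch G F F' ∧
      ∀ u v, F'.Adj u v ↔ (F.Adj u v ∧ s(u, v) ≠ s(x, y) ∧ s(u, v) ≠ s(z, w)) ∨
        s(u, v) = s(y, z) ∨ s(u, v) = s(w, x) := by
  let F' : SimpleGraph V :=
    { Adj := fun u v => (F.Adj u v ∧ s(u, v) ≠ s(x, y) ∧ s(u, v) ≠ s(z, w)) ∨
        s(u, v) = s(y, z) ∨ s(u, v) = s(w, x)
      symm := ⟨fun u v h => by rw [Sym2.eq_swap, F.adj_comm]; exact h⟩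
      loopless := ⟨fun u h => by
        have h1 := hyz.ne
        have h2 := hwx.ne
        have h3 := F.loopless.irrefl u
        rw [Sym2.eq_iff, Sym2.eq_iff] at h
        grind⟩ }
  have hadj : ∀ u v, F'.Adj u v ↔ (F.Adj u v ∧ s(u, v) ≠ s(x, y) ∧ s(u, v) ≠ s(z, w)) ∨
        s(u, v) = s(y, z) ∨ s(u, v) = s(w, x) := fun _ _ => Iff.rfl
  have nzy : ¬ F.Adj z y := fun h => nyz h.symm
  have nxw : ¬ F.Adj x w := fun h => nwx h.symm
  have e1 := hxy.ne
  have e2 := hzw.ne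
  have e3 := hyz.ne
  have e4 := hwx.ne
  refine ⟨F', ⟨fun u v h => ?_, fun v => ?_⟩, ⟨{s(x, y), s(y, z), s(z, w), s(w, x)},
    ⟨⟨x, y, z, w, hxz, hyw, hF.1 hxy, hyz, hF.1 hzw, hwx, rfl⟩, s(x, y), s(z, w), ?_, ?_⟩, ?_⟩, hadj⟩
  · rw [hadj, Sym2.eq_iff, Sym2.eq_iff] at h
    rcases h with h | (⟨rfl, rfl⟩ | ⟨rfl, rfl⟩) | (⟨rfl, rfl⟩ | ⟨rfl, rfl⟩)
    · exact hF.1 h.1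
    · exact hyz
    · exact hyz.symm
    · exact hwx
    · exact hwx.symm
  · by_cases hx : v = x
    · subst hx
      refine ncard_eq_two_of_exchange (hF.2 v) (p := w) (q := y) hxy nxw fun u => ?_
      simp only [SimpleGraph.mem_neighborSet, hadj, ne_eq, Sym2.eq_iff]
      grind
    by_cases hy : v = y
    · subst hy
      refine ncard_eq_two_of_exchange (hF.2 v) (p := z) (q := x) hxy.symm nyz fun u => ?_
      simp only [SimpleGraph.mem_neighborSet, hadj, ne_eq, Sym2.eq_iff]
      grind
    by_cases hz : v = z
    · subst hz
      refine ncard_eq_two_of_exchange (hF.2 v) (p := y) (q := w) hzw nzy fun u => ?_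
      simp only [SimpleGraph.mem_neighborSet, hadj, ne_eq, Sym2.eq_iff]
      grind
    by_cases hw : v = w
    · subst hw
      refine ncard_eq_two_of_exchange (hF.2 v) (p := x) (q := z) hzw.symm nwx fun u => ?_
      simp only [SimpleGraph.mem_neighborSet, hadj, ne_eq, Sym2.eq_iff]
      grind
    have : F'.neighborSet v = F.neighborSet v := by
      ext u
      simp only [SimpleGraph.mem_neighborSet, hadj, ne_eq, Sym2.eq_iff]
      grind
    rw [this, hF.2]
  · intro v
    rw [Sym2.mem_iff, Sym2.mem_iff]
    grind
  · ext e
    induction e using Sym2.ind with | _ u v => ?_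
    simp only [Set.mem_inter_iff, Set.mem_insert_iff, Set.mem_singleton_iff, Sym2.eq_iff,
      SimpleGraph.mem_edgeSet]
    constructor
    · rintro ⟨(⟨rfl, rfl⟩ | ⟨rfl, rfl⟩) | (⟨rfl, rfl⟩ | ⟨rfl, rfl⟩) | (⟨rfl, rfl⟩ | ⟨rfl, rfl⟩) |
        (⟨rfl, rfl⟩ | ⟨rfl, rfl⟩), h⟩ <;> tauto
    · rintro ((⟨rfl, rfl⟩ | ⟨rfl, rfl⟩) | (⟨rfl, rfl⟩ | ⟨rfl, rfl⟩))
      · exact ⟨Or.inl (Or.inl ⟨rfl, rfl⟩), hxy⟩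
      · exact ⟨Or.inl (Or.inr ⟨rfl, rfl⟩), hxy.symm⟩
      · exact ⟨Or.inr (Or.inr (Or.inl (Or.inl ⟨rfl, rfl⟩))), hzw⟩
      · exact ⟨Or.inr (Or.inr (Or.inl (Or.inr ⟨rfl, rfl⟩))), hzw.symm⟩
  · ext e
    have h1 : s(y, z) ∉ F.edgeSet := nyz
    have h2 : s(w, x) ∉ F.edgeSet := nwx
    have h3 : s(x, y) ∈ F.edgeSet := hxy
    have h4 : s(z, w) ∈ F.edgeSet := hzw
    have h5 : e ∈ F'.edgeSet ↔ (e ∈ F.edgeSet ∧ e ≠ s(x, y) ∧ e ≠ s(z, w)) ∨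
        e = s(y, z) ∨ e = s(w, x) := by
      induction e using Sym2.ind with | _ u v => exact hadj u v
    rw [h5, Set.mem_symmDiff]
    simp only [Set.mem_insert_iff, Set.mem_singleton_iff]
    grind

/-- Passing from `F` to `F'` changes only edges inside `U`. -/
def AgreeOff (U : Finset V) (F F' : SimpleGraph V) : Prop :=
  ∀ u v, u ∉ U → (F'.Adj u v ↔ F.Adj u v)

theorem AgreeOff.trans [DecidableEq V] {U U' : Finset V} {F F' F'' : SimpleGraph V}
    (h : AgreeOff U F F') (h' : AgreeOff U' F' F'') : AgreeOff (U ∪ U') F F'' := by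
  intro u v hu
  rw [Finset.mem_union, not_or] at hu
  exact (h' u v hu.2).trans (h u v hu.1)

theorem agreeOff_c4 [DecidableEq V] {F F' : SimpleGraph V} {x y z w : V}
    (h : ∀ u v, F'.Adj u v ↔ (F.Adj u v ∧ s(u, v) ≠ s(x, y) ∧ s(u, v) ≠ s(z, w)) ∨
        s(u, v) = s(y, z) ∨ s(u, v) = s(w, x)) : AgreeOff {x, y, z, w} F F' := by
  intro u v hu
  simp only [Finset.mem_insert, Finset.mem_singleton, not_or] at hu
  rw [h]
  simp only [ne_eq, Sym2.eq_iff]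
  grind

theorem Orients.edge_injective {F : SimpleGraph V} {σ : Perm V} (hσ : Orients σ F)
    (hF : ∀ v, (F.neighborSet v).ncard = 2) {u v : V} (h : s(u, σ u) = s(v, σ v)) : u = v := by
  rw [Sym2.eq_iff] at h
  rcases h with h | ⟨rfl, h⟩
  · exact h.1
  · exact absurd h (hσ.ne_two hF v)

/-- Leaving `y` and `z` free covers both kinds of switch: `y = a`, `z = σ a` is the parallel one, `y
= σ a`, `z = a` the antiparallel one. -/
theorem orients_of_c4 {F F' : SimpleGraph V} {σ τ : Perm V}
    (hF : ∀ v, (F.neighborSet v).ncard = 2) (hσ : Orients σ F) {x a y z : V}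
    (h : ∀ u v, F'.Adj u v ↔ (F.Adj u v ∧ s(u, v) ≠ s(x, σ x) ∧ s(u, v) ≠ s(a, σ a)) ∨
        s(u, v) = s(σ x, y) ∨ s(u, v) = s(z, x))
    (h1 : ∀ v, v ≠ x → v ≠ a → τ v = σ v ∨ τ (σ v) = v)
    (h2 : ∀ v, (∃ u, u ≠ x ∧ u ≠ a ∧ s(v, τ v) = s(u, σ u)) ∨ s(v, τ v) = s(σ x, y) ∨
      s(v, τ v) = s(z, x))
    (h3 : τ (σ x) = y ∨ τ y = σ x) (h4 : τ z = x ∨ τ x = z) : Orients τ F' := by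
  have hadj : ∀ v, F'.Adj v (τ v) := by
    intro v
    rw [h]
    rcases h2 v with ⟨u, hux, hua, huv⟩ | h2
    · left
      rw [huv]
      refine ⟨?_, fun h => hux (hσ.edge_injective hF h), fun h => hua (hσ.edge_injective hF h)⟩
      rw [← SimpleGraph.mem_edgeSet, huv]
      exact hσ.adj u
    · exact Or.inr h2
  intro u v
  constructor
  · intro huv
    rcases (h u v).1 huv with ⟨h5, h6, h7⟩ | h5 | h5
    · rcases (hσ u v).1 h5 with rfl | rfl
      · exact h1 u (fun h => h6 (h ▸ rfl)) (fun h => h7 (h ▸ rfl))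
      · rw [Sym2.eq_swap] at h6 h7
        exact (h1 v (fun h => h6 (h ▸ rfl)) (fun h => h7 (h ▸ rfl))).symm
    · rcases Sym2.eq_iff.1 h5 with ⟨rfl, rfl⟩ | ⟨rfl, rfl⟩
      · exact h3
      · exact h3.symm
    · rcases Sym2.eq_iff.1 h5 with ⟨rfl, rfl⟩ | ⟨rfl, rfl⟩
      · exact h4
      · exact h4.symm
  · rintro (rfl | rfl)
    · exact hadj u
    · exact (hadj v).symm

variable [DecidableEq V]

/-- Switching two edges of `F` that are traversed in compatible directions. -/
theorem exists_parallel_switch {G F : SimpleGraph V} {σ : Perm V} (hF : IsTwoFactor G F)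
    (hσ : Orients σ F) {x a : V} (hxa : x ≠ a) (h1 : G.Adj x (σ a)) (h2 : G.Adj a (σ x))
    (n1 : ¬ F.Adj x (σ a)) (n2 : ¬ F.Adj a (σ x)) :
    ∃ F' : SimpleGraph V, IsTwoFactor G F' ∧ IsC4Switch G F F' ∧ Orients (σ * swap x a) F' ∧
      ∃ U : Finset V, U.card ≤ 4 ∧ AgreeOff U F F' := by
  obtain ⟨F', h3, h4, h5⟩ := exists_c4Switch hF hxa (σ.injective.ne hxa) (hσ.adj x) (hσ.adj a)
    h2.symm h1.symm (fun h => n2 h.symm) (fun h => n1 h.symm)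
  refine ⟨F', h3, h4, ?_, _, Finset.card_le_four, agreeOff_c4 h5⟩
  refine orients_of_c4 hF.2 hσ h5 (fun v hx ha => Or.inl (mul_swap_apply_of_ne hx ha))
    (fun v => ?_) (Or.inr mul_swap_apply_right) (Or.inr mul_swap_apply_left)
  by_cases hx : v = x
  · subst hx
    rw [mul_swap_apply_left, Sym2.eq_swap]
    exact Or.inr (Or.inr rfl)
  by_cases ha : v = a
  · subst ha
    rw [mul_swap_apply_right, Sym2.eq_swap]
    exact Or.inr (Or.inl rfl)
  rw [mul_swap_apply_of_ne hx ha]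
  exact Or.inl ⟨v, hx, ha, rfl⟩

end Switching

/-! ### Switch sequences that gain one cycle -/

section Increment

open Equiv Equiv.Perm

variable {V : Type*}

/-- A bounded number of switches turns `F` into a 2-factor with one more cycle. -/
def Improvable (G F : SimpleGraph V) : Prop :=
  ∃ F' : SimpleGraph V, IsTwoFactor G F' ∧ Relation.ReflTransGen (IsC4Switch G) F F' ∧
    numCycles F' = numCycles F + 1 ∧ ∃ U : Finset V, U.card ≤ 12 ∧ AgreeOff U F F'

variable [DecidableEq V]

/-- Reversing the arc of a cycle of `σ` from `σ x` to `a`. -/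
noncomputable def revArc (σ : Perm V) (x a : V) : Perm V :=
  revCycle (σ * swap x a) a * swap x (σ x)

section revArc

variable {σ : Perm V} {x a : V}

theorem sameCycle_arc_apply : SameCycle (σ * swap x a) a (σ x) := by
  rw [← mul_swap_apply_right (x := x) (a := a), sameCycle_apply_right]

theorem revArc_apply_left : revArc σ x a x = a := by
  rw [revArc, mul_swap_apply_left, ← mul_swap_apply_right (x := x) (a := a),
    revCycle_apply_of_sameCycle (SameCycle.refl _ _)]

theorem revArc_apply_of_notMem {v : V}
    (hv : ¬ SameCycle (σ * swap x a) a v) (hvx : v ≠ x) : revArc σ x a v = σ v := by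
  have hva : v ≠ a := fun h => hv (h ▸ SameCycle.refl _ _)
  have h1 : v ≠ σ x := fun h => hv (h ▸ sameCycle_arc_apply)
  rw [revArc, mul_swap_apply_of_ne hvx h1, revCycle_apply_of_not hv, mul_swap_apply_of_ne hvx hva]

variable [Finite V]

theorem not_sameCycle_arc (hs : SameCycle σ x a) (hxa : x ≠ a) :
    ¬ SameCycle (revCycle (σ * swap x a) a) x (σ x) := fun h =>
  not_sameCycle_mul_swap hs hxa (sameCycle_arc_apply.trans (sameCycle_revCycle.1 h).symm)

/-- The arc is split off, reversed and glued back: the count changes by 1, 0 and -1. -/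
theorem cyc_revArc (hs : SameCycle σ x a) (hxa : x ≠ a) : cyc (revArc σ x a) = cyc σ := by
  have h1 := cyc_mul_swap_of_not_sameCycle (not_sameCycle_arc hs hxa)
  rw [cyc_revCycle, cyc_mul_swap_of_sameCycle hs hxa] at h1
  exact Nat.succ_injective h1

theorem revArc_apply_right (hs : SameCycle σ x a) (hxa : x ≠ a) :
    revArc σ x a (σ x) = σ a := by
  rw [revArc, mul_swap_apply_right, revCycle_apply_of_not (not_sameCycle_mul_swap hs hxa),
    mul_swap_apply_left]

theorem revArc_apply_of_mem (hs : SameCycle σ x a) (hxa : x ≠ a) {v : V}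
    (hv : SameCycle (σ * swap x a) a v) (hva : v ≠ a) : revArc σ x a (σ v) = v := by
  have hn := not_sameCycle_mul_swap hs hxa
  have hvx : v ≠ x := fun h => hn (h ▸ hv)
  have hρ : (σ * swap x a) v = σ v := mul_swap_apply_of_ne hvx hva
  have h1 : σ v ≠ x := fun h => hn (by
    have h2 := sameCycle_apply_right.2 hv
    rwa [hρ, h] at h2)
  rw [revArc, mul_swap_apply_of_ne h1 (σ.injective.ne hvx), ← hρ, revCycle_apply_of_sameCycle hv]

end revArc

variable [Finite V]

theorem improvable_of_parallel {G F : SimpleGraph V} {σ : Perm V} (hF : IsTwoFactor G F)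
    (hσ : Orients σ F) {x a : V} (hxa : x ≠ a) (hs : SameCycle σ x a) (h1 : G.Adj x (σ a))
    (h2 : G.Adj a (σ x)) (n1 : ¬ F.Adj x (σ a)) (n2 : ¬ F.Adj a (σ x)) : Improvable G F := by
  obtain ⟨F', h3, h4, h5, U, hU, h6⟩ := exists_parallel_switch hF hσ hxa h1 h2 n1 n2
  refine ⟨F', h3, .single h4, ?_, U, by omega, h6⟩
  rw [h5.numCycles_eq, hσ.numCycles_eq, cyc_mul_swap_of_sameCycle hs hxa]

/-- Switching two edges of a cycle of `F` that are traversed in opposite directions. -/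
theorem exists_antiparallel_switch {G F : SimpleGraph V} {σ : Perm V} (hF : IsTwoFactor G F)
    (hσ : Orients σ F) {x a : V} (hxa : x ≠ a) (hs : SameCycle σ x a) (h1 : G.Adj x a)
    (h2 : G.Adj (σ x) (σ a)) (n1 : ¬ F.Adj x a) (n2 : ¬ F.Adj (σ x) (σ a)) :
    ∃ F' : SimpleGraph V, IsTwoFactor G F' ∧ IsC4Switch G F F' ∧ Orients (revArc σ x a) F' ∧
      ∃ U : Finset V, U.card ≤ 4 ∧ AgreeOff U F F' := by
  obtain ⟨F', h3, h4, h5⟩ := exists_c4Switch hF (x := x) (y := σ x) (z := σ a) (w := a)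
    (fun h => n1 ((hσ x a).2 (Or.inr h.symm))) (fun h => n1 ((hσ x a).2 (Or.inl h)))
    (hσ.adj x) (hσ.adj a).symm h2 h1.symm n2 (fun h => n1 h.symm)
  refine ⟨F', h3, h4, ?_, _, Finset.card_le_four, agreeOff_c4 h5⟩
  rw [Sym2.eq_swap (a := σ a)] at h5
  refine orients_of_c4 hF.2 hσ h5 (fun v hx ha => ?_) (fun v => ?_)
    (Or.inl (revArc_apply_right hs hxa)) (Or.inr revArc_apply_left)
  · by_cases hv : SameCycle (σ * swap x a) a v
    · exact Or.inr (revArc_apply_of_mem hs hxa hv ha)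
    · exact Or.inl (revArc_apply_of_notMem hv hx)
  · by_cases hx : v = x
    · subst hx
      rw [revArc_apply_left, Sym2.eq_swap]
      exact Or.inr (Or.inr rfl)
    by_cases hx' : v = σ x
    · subst hx'
      rw [revArc_apply_right hs hxa]
      exact Or.inr (Or.inl rfl)
    left
    -- On the reversed arc old edges are run backwards, elsewhere forwards.
    by_cases hv : SameCycle (σ * swap x a) a v
    · obtain ⟨u, rfl⟩ := (σ * swap x a).surjective v
      rw [sameCycle_apply_right] at hv
      have hua : u ≠ a := fun h => hx' (h ▸ mul_swap_apply_right)
      have hux : u ≠ x := by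
        rintro rfl
        exact not_sameCycle_mul_swap hs hxa hv
      rw [mul_swap_apply_of_ne hux hua, revArc_apply_of_mem hs hxa hv hua, Sym2.eq_swap]
      exact ⟨u, hux, hua, rfl⟩
    · rw [revArc_apply_of_notMem hv hx]
      exact ⟨v, hx, fun h => hv (h ▸ SameCycle.refl _ _), rfl⟩

/-- Two crossing antiparallel chords of a cycle allow to split it. -/
theorem improvable_of_crossing {G F : SimpleGraph V} {σ : Perm V} (hF : IsTwoFactor G F)
    (hσ : Orients σ F) {x a x' a' : V} (hxa : x ≠ a) (hs : SameCycle σ x a) (h1 : G.Adj x a)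
    (h2 : G.Adj (σ x) (σ a)) (n1 : ¬ F.Adj x a) (n2 : ¬ F.Adj (σ x) (σ a))
    (hx' : SameCycle (σ * swap x a) a x') (ha' : SameCycle (σ * swap x a) x a')
    (h1' : G.Adj x' a') (h2' : G.Adj (σ x') (σ a'))
    (e1 : x' ≠ a) (e2 : a' ≠ x) (e3 : x' ≠ σ x) (e4 : σ x' ≠ a) : Improvable G F := by
  have hn := not_sameCycle_mul_swap hs hxa
  have hna' : ¬ SameCycle (σ * swap x a) a a' := fun h => hn (h.trans ha'.symm)
  have hσx' : SameCycle (σ * swap x a) a (σ x') := by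
    have hx'x : x' ≠ x := fun h => hn (h ▸ hx')
    rw [← mul_swap_apply_of_ne hx'x e1, sameCycle_apply_right]
    exact hx'
  have hσa' : ¬ SameCycle (σ * swap x a) a (σ a') := by
    have ha'a : a' ≠ a := fun h => hna' (h ▸ SameCycle.refl _ _)
    rw [← mul_swap_apply_of_ne e2 ha'a, sameCycle_apply_right]
    exact hna'
  -- Only the end `x'` of the second chord lies on the reversed arc, so the second 4-cycle is now
  -- parallel, with initial points `σ x'` and `a'`.
  have t1 : revArc σ x a (σ x') = x' := revArc_apply_of_mem hs hxa hx' e1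
  have t2 : revArc σ x a a' = σ a' := revArc_apply_of_notMem hna' e2
  obtain ⟨F', f1, f2, f3, U, hU, f4⟩ := exists_antiparallel_switch hF hσ hxa hs h1 h2 n1 n2
  have m1 : SameCycle (revArc σ x a) (σ x') a' := by
    have hm := not_sameCycle_arc hs hxa
    have k1 : SameCycle (revArc σ x a) (σ x') (σ x) :=
      sameCycle_mul_swap_of_sameCycle hm (sameCycle_revCycle.2 (hσx'.symm.trans sameCycle_arc_apply))
    have k2 : SameCycle (revArc σ x a) x a' :=
      sameCycle_mul_swap_of_sameCycle hm (sameCycle_revCycle.2 ha')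
    exact (k1.trans (sameCycle_mul_swap hm).symm).trans k2
  -- The separation hypotheses `e3` and `e4` ensure that the first switch has not already inserted
  -- the edges needed now.
  have q1 : ¬ F'.Adj (σ x') (revArc σ x a a') := by
    rw [t2, f3, t1]
    rintro (h | h)
    · exact hσa' (h ▸ hx')
    · by_cases hc : σ a' = x
      · rw [hc, revArc_apply_left] at h
        exact e4 h.symm
      · rw [revArc_apply_of_notMem hσa' hc] at h
        have := σ.injective h
        have hd : σ a' ≠ a := fun h => hσa' (h ▸ SameCycle.refl _ _)
        exact hσa' (this ▸ hx')
  have q2 : ¬ F'.Adj a' (revArc σ x a (σ x')) := by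
    rw [t1, f3, t2]
    rintro (h | h)
    · exact hσa' (h ▸ hx')
    · obtain ⟨u, hu⟩ := (σ * swap x a).surjective x'
      have hu' : SameCycle (σ * swap x a) a u := by
        rw [← sameCycle_apply_right, hu]; exact hx'
      have hux : u ≠ x := fun h => hn (h ▸ hu')
      have hua : u ≠ a := by
        rintro rfl
        rw [mul_swap_apply_right] at hu
        exact e3 hu.symm
      rw [mul_swap_apply_of_ne hux hua] at hu
      rw [← hu, revArc_apply_of_mem hs hxa hu' hua] at h
      exact hna' (h ▸ hu')
  have hne : σ x' ≠ a' := fun h => hna' (h ▸ hσx')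
  obtain ⟨F'', g1, g2, g3, U', hU', g4⟩ := exists_parallel_switch f1 f3 hne
    (by rw [t2]; exact h2') (by rw [t1]; exact h1'.symm) q1 q2
  refine ⟨F'', g1, .tail (.single f2) g2, ?_, U ∪ U', ?_, f4.trans g4⟩
  · rw [g3.numCycles_eq, hσ.numCycles_eq, cyc_mul_swap_of_sameCycle m1 hne,
      cyc_revArc hs hxa]
  · have := Finset.card_union_le U U'
    omega

/-- Three switches between two cycles, the first of which merges them. -/
theorem improvable_of_three_pairs {G F : SimpleGraph V} {σ : Perm V} (hF : IsTwoFactor G F)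
    (hσ : Orients σ F) {x₁ x₂ x₃ b₁ b₂ b₃ : V} (hd : ¬ SameCycle σ x₁ b₁)
    (hx₂ : SameCycle σ x₁ x₂) (hx₃ : SameCycle σ x₁ x₃) (hb₂ : SameCycle σ b₁ b₂)
    (hb₃ : SameCycle σ b₁ b₃)
    (h₁ : G.Adj x₁ (σ b₁)) (h₁' : G.Adj b₁ (σ x₁)) (h₂ : G.Adj x₂ (σ b₂)) (h₂' : G.Adj b₂ (σ x₂))
    (h₃ : G.Adj x₃ (σ b₃)) (h₃' : G.Adj b₃ (σ x₃))
    (x₁₂ : x₁ ≠ x₂) (x₁₃ : x₁ ≠ x₃) (x₂₃ : x₂ ≠ x₃)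
    (b₁₂ : b₁ ≠ b₂) (b₁₃ : b₁ ≠ b₃) (b₂₃ : b₂ ≠ b₃)
    (s₁₂ : σ x₁ ≠ x₂) (s₂₁ : σ x₂ ≠ x₁) (s₁₃ : σ x₁ ≠ x₃) (s₃₁ : σ x₃ ≠ x₁)
    (s₂₃ : σ x₂ ≠ x₃) (s₃₂ : σ x₃ ≠ x₂)
    (hs : SameCycle (σ * swap x₁ b₁ * swap x₂ b₂) x₃ b₃) : Improvable G F := by
  have hne : ∀ u v, SameCycle σ x₁ u → SameCycle σ b₁ v → u ≠ v := fun u v hu hv h =>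
    hd (hu.trans (h ▸ hv.symm))
  have rx := SameCycle.refl σ x₁
  have rb := SameCycle.refl σ b₁
  have sx : ∀ {u}, SameCycle σ x₁ u → SameCycle σ x₁ (σ u) := fun h => sameCycle_apply_right.2 h
  have sb : ∀ {u}, SameCycle σ b₁ u → SameCycle σ b₁ (σ u) := fun h => sameCycle_apply_right.2 h
  -- Edges between the two cycles are absent from `F`; below, the conditions on `σ` keep them from
  -- being inserted by the earlier switches.
  have hnadj : ∀ u v, SameCycle σ x₁ u → SameCycle σ b₁ v → ¬ F.Adj u v := by
    intro u v hu hv h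
    rcases (hσ u v).1 h with h | h
    · exact hne _ _ (sx hu) hv h
    · exact hne _ _ hu (sb hv) h.symm
  obtain ⟨F₁, p1, p2, p3, U₁, hU₁, p4⟩ := exists_parallel_switch hF hσ (hne _ _ rx rb) h₁ h₁'
    (hnadj _ _ rx (sb rb)) (fun h => hnadj _ _ (sx rx) rb h.symm)
  have c1 := cyc_mul_swap_of_not_sameCycle hd
  have a1 : ∀ v, v ≠ x₁ → v ≠ b₁ → (σ * swap x₁ b₁) v = σ v := fun v h h' =>
    mul_swap_apply_of_ne h h'
  have ax₂ := a1 x₂ x₁₂.symm (hne _ _ hx₂ rb)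
  have ab₂ := a1 b₂ (hne _ _ rx hb₂).symm b₁₂.symm
  have n1 : ¬ F₁.Adj x₂ (σ b₂) := by
    rw [p3, ax₂]
    rintro (h | h)
    · exact hne _ _ (sx hx₂) (sb hb₂) h
    · by_cases hc : σ b₂ = b₁
      · rw [hc, mul_swap_apply_right] at h
        exact s₁₂ h
      · rw [a1 _ (hne _ _ rx (sb hb₂)).symm hc] at h
        exact hne _ _ hx₂ (sb (sb hb₂)) h.symm
  have n2 : ¬ F₁.Adj b₂ (σ x₂) := by
    rw [p3, ab₂]
    rintro (h | h)
    · exact hne _ _ (sx hx₂) (sb hb₂) h.symm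
    · rw [a1 _ s₂₁ (hne _ _ (sx hx₂) rb)] at h
      exact hne _ _ (sx (sx hx₂)) hb₂ h
  obtain ⟨F₂, q1, q2, q3, U₂, hU₂, q4⟩ := exists_parallel_switch p1 p3 (hne _ _ hx₂ hb₂)
    (ab₂.symm ▸ h₂) (ax₂.symm ▸ h₂') (ab₂.symm ▸ n1) (ax₂.symm ▸ n2)
  -- After the merge every second pair lies on a common cycle, so the second switch splits; `hs`
  -- makes the third split as well.
  have m2 : SameCycle (σ * swap x₁ b₁) x₂ b₂ :=
    ((sameCycle_mul_swap_of_sameCycle hd hx₂.symm).trans (sameCycle_mul_swap hd)).trans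
      (sameCycle_mul_swap_of_sameCycle hd hb₂)
  have c2 := cyc_mul_swap_of_sameCycle m2 (hne _ _ hx₂ hb₂)
  have a2 : ∀ v, v ≠ x₁ → v ≠ b₁ → v ≠ x₂ → v ≠ b₂ →
      (σ * swap x₁ b₁ * swap x₂ b₂) v = σ v := fun v h h' h'' h''' => by
    rw [mul_swap_apply_of_ne h'' h''', a1 v h h']
  have ax₃ := a2 x₃ x₁₃.symm (hne _ _ hx₃ rb) x₂₃.symm (hne _ _ hx₃ hb₂)
  have ab₃ := a2 b₃ (hne _ _ rx hb₃).symm b₁₃.symm (hne _ _ hx₂ hb₃).symm b₂₃.symm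
  have n3 : ¬ F₂.Adj x₃ (σ b₃) := by
    rw [q3, ax₃]
    rintro (h | h)
    · exact hne _ _ (sx hx₃) (sb hb₃) h
    · by_cases hc : σ b₃ = b₂
      · rw [hc, mul_swap_apply_right, ax₂] at h
        exact s₂₃ h
      by_cases hc' : σ b₃ = b₁
      · rw [hc', mul_swap_apply_of_ne (hne _ _ hx₂ rb).symm b₁₂, mul_swap_apply_right] at h
        exact s₁₃ h
      · rw [a2 _ (hne _ _ rx (sb hb₃)).symm hc' (hne _ _ hx₂ (sb hb₃)).symm hc] at h
        exact hne _ _ hx₃ (sb (sb hb₃)) h.symm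
  have n4 : ¬ F₂.Adj b₃ (σ x₃) := by
    rw [q3, ab₃]
    rintro (h | h)
    · exact hne _ _ (sx hx₃) (sb hb₃) h.symm
    · rw [a2 _ s₃₁ (hne _ _ (sx hx₃) rb) s₃₂ (hne _ _ (sx hx₃) hb₂)] at h
      exact hne _ _ (sx (sx hx₃)) hb₃ h
  obtain ⟨F₃, r1, r2, r3, U₃, hU₃, r4⟩ := exists_parallel_switch q1 q3 (hne _ _ hx₃ hb₃)
    (ab₃.symm ▸ h₃) (ax₃.symm ▸ h₃') (ab₃.symm ▸ n3) (ax₃.symm ▸ n4)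
  have c3 := cyc_mul_swap_of_sameCycle hs (hne _ _ hx₃ hb₃)
  refine ⟨F₃, r1, .tail (.tail (.single p2) q2) r2, ?_, U₁ ∪ U₂ ∪ U₃, ?_, (p4.trans q4).trans r4⟩
  · rw [r3.numCycles_eq, hσ.numCycles_eq]
    omega
  · have := Finset.card_union_le U₁ U₂
    have := Finset.card_union_le (U₁ ∪ U₂) U₃
    omega

end Increment

/-! ### Numbering the points of each cycle -/

section Positions

open Equiv Equiv.Perm

variable {V : Type*}

/-- `pos` numbers the points of each cycle of `σ` consecutively. -/
structure IsPosition (σ : Perm V) (pos : V → ℕ) : Prop where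
  inj : ∀ u v, SameCycle σ u v → pos u = pos v → u = v
  step : ∀ v z, SameCycle σ v z → pos v < pos z → pos v < pos (σ v) ∧ pos (σ v) ≤ pos z
  zero_or_lt : ∀ v, pos (σ v) = 0 ∨ pos v < pos (σ v)

theorem exists_isPosition [Finite V] (σ : Perm V) : ∃ pos, IsPosition σ pos := by
  classical
  let rep : V → V := fun v => Quotient.out (Quotient.mk (SameCycle.setoid σ) v)
  have hrep : ∀ v, SameCycle σ (rep v) v := fun v => Quotient.mk_out (s := SameCycle.setoid σ) v
  have hrep' : ∀ u v, SameCycle σ u v → rep u = rep v := fun u v h =>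
    congrArg Quotient.out (Quotient.sound (s := SameCycle.setoid σ) h)
  have hex : ∀ v, ∃ m : ℕ, (σ ^ m) (rep v) = v := fun v => by
    obtain ⟨m, -, hm⟩ := (hrep v).exists_pow_eq'
    exact ⟨m, hm⟩
  -- The number of steps from the chosen representative of the cycle.
  let pos : V → ℕ := fun v => Nat.find (hex v)
  have hpos : ∀ v, (σ ^ pos v) (rep v) = v := fun v => Nat.find_spec (hex v)
  have hle : ∀ v m, (σ ^ m) (rep v) = v → pos v ≤ m := fun v m h => Nat.find_min' (hex v) h
  have hσ : ∀ v, rep (σ v) = rep v := fun v =>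
    hrep' _ _ (sameCycle_apply_left.2 (SameCycle.refl _ _))
  have hsucc : ∀ v, (σ ^ (pos v + 1)) (rep v) = σ v := fun v => by
    rw [pow_succ', Perm.mul_apply, hpos]
  have hz : ∀ v, pos (σ v) = 0 ∨ pos v < pos (σ v) := by
    intro v
    rcases Nat.eq_zero_or_eq_succ_pred (pos (σ v)) with h | h
    · exact Or.inl h
    · right
      have h1 := hpos (σ v)
      rw [h, hσ, Nat.succ_eq_add_one, pow_succ', Perm.mul_apply] at h1
      have := hle v _ (σ.injective h1)
      omega
  refine ⟨pos, fun u v h huv => ?_, fun v z hvz hlt => ?_, hz⟩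
  · rw [← hpos u, ← hpos v, hrep' u v h, huv]
  · have h1 : pos (σ v) ≤ pos v + 1 := hle _ _ (by rw [hσ, hsucc])
    -- If `σ v` were the representative, the cycle would close after `v`, and `z` would be reached
    -- in fewer steps than its position.
    refine ⟨?_, by omega⟩
    by_contra hcon
    have h0 : pos (σ v) = 0 := (hz v).resolve_right hcon
    have h2 : rep v = σ v := by
      have := hpos (σ v)
      rwa [h0, hσ, pow_zero, Perm.one_apply] at this
    have h3 := hpos z
    rw [← hrep' v z hvz, show pos z = (pos z - (pos v + 1)) + (pos v + 1) by omega, pow_add,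
      Perm.mul_apply, hsucc, ← h2, hrep' v z hvz] at h3
    have := hle z _ h3
    omega

variable {σ : Perm V} {pos : V → ℕ}

/-- Induction along the arc from `y` to `z`, which does not wrap around. This certifies that an arc
survives the switches. -/
theorem IsPosition.sameCycle (hp : IsPosition σ pos) {τ : Perm V} {z : V} :
    ∀ {y : V}, SameCycle σ y z → pos y ≤ pos z →
      (∀ w, SameCycle σ y w → pos y ≤ pos w → pos w < pos z → SameCycle τ w (σ w)) →
      SameCycle τ y z := by
  suffices H : ∀ (d : ℕ) (y : V), SameCycle σ y z → pos y ≤ pos z → pos z - pos y ≤ d →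
      (∀ w, SameCycle σ y w → pos y ≤ pos w → pos w < pos z → SameCycle τ w (σ w)) →
      SameCycle τ y z from fun {y} hs hle h => H _ y hs hle le_rfl h
  intro d
  induction d with
  | zero =>
    intro y hs hle hd _
    rw [hp.inj y z hs (by omega)]
  | succ d ih =>
    intro y hs hle hd h
    rcases hle.eq_or_lt with heq | hlt
    · rw [hp.inj y z hs heq]
    · obtain ⟨h1, h2⟩ := hp.step y z hs hlt
      refine (h y (SameCycle.refl _ _) le_rfl hlt).trans
        (ih _ (sameCycle_apply_left.2 hs) h2 (by omega) fun w hw hw1 hw2 => ?_)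
      exact h w (sameCycle_apply_left.1 hw) (by omega) hw2

theorem IsPosition.apply_ne_of_between (hp : IsPosition σ pos) {x m y : V} (hs : SameCycle σ x m)
    (h1 : pos x < pos m) (h2 : pos m < pos y) : σ x ≠ y := by
  rintro rfl
  have := (hp.step x m hs h1).2
  omega

/-- A step of `σ` that does not raise the position lands at position 0. -/
theorem IsPosition.apply_ne_of_lt (hp : IsPosition σ pos) {x y : V}
    (h0 : 0 < pos y) (h : pos y < pos x) : σ x ≠ y := by
  rintro rfl
  have := hp.zero_or_lt x
  omega

end Positions

/-! ### Monotone chains by discarding minimal pairs -/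

section Peeling

open Equiv Equiv.Perm

/-- Discard from each fibre of `key` its element of least value; every survivor then has a smaller
companion in its fibre. -/
theorem exists_peel {P K T : Type*} [Fintype K] [LinearOrder T] (S : Finset P) (key : P → K)
    (val : P → T) (hinj : ∀ p ∈ S, ∀ q ∈ S, key p = key q → val p = val q → p = q) :
    ∃ S' ⊆ S, S.card ≤ S'.card + Fintype.card K ∧
      ∀ p ∈ S', ∃ q ∈ S, key q = key p ∧ val q < val p := by
  classical
  refine ⟨S.filter fun p => ∃ q ∈ S, key q = key p ∧ val q < val p, Finset.filter_subset _ _, ?_,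
    fun p hp => (Finset.mem_filter.1 hp).2⟩
  rw [← Finset.card_filter_add_card_filter_not (s := S)
    (fun p => ∃ q ∈ S, key q = key p ∧ val q < val p)]
  refine Nat.add_le_add_left ?_ _
  rw [← Finset.card_univ]
  refine Finset.card_le_card_of_injOn key (fun _ _ => Finset.mem_coe.2 (Finset.mem_univ _)) ?_
  intro p hp q hq hpq
  have hp := Finset.mem_filter.1 hp
  have hq := Finset.mem_filter.1 hq
  push Not at hp hq
  exact hinj p hp.1 q hq.1 hpq (le_antisymm (hp.2 q hq.1 hpq.symm) (hq.2 p hp.1 hpq))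

variable {V T T' : Type*} [Fintype V] [LinearOrder T] [LinearOrder T'] {σ : Perm V}

/-- The fibres are indexed by the second coordinate and the cycle of the first, which bounds the
loss. -/
theorem exists_peel_fst (S : Finset (V × V)) (f : V → T)
    (hf : ∀ u v, SameCycle σ u v → f u = f v → u = v) :
    ∃ S' ⊆ S, S.card ≤ S'.card + Fintype.card V * cyc σ ∧
      ∀ x a, (x, a) ∈ S' → ∃ y, (y, a) ∈ S ∧ SameCycle σ y x ∧ f y < f x := by
  classical
  have : Fintype (Quotient (SameCycle.setoid σ)) := Fintype.ofFinite _
  obtain ⟨S', h1, h2, h3⟩ := exists_peel S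
    (fun p => (p.2, Quotient.mk (SameCycle.setoid σ) p.1)) (fun p => f p.1) (by
      rintro ⟨x, a⟩ - ⟨y, b⟩ - hk hv
      obtain ⟨rfl, hk⟩ := Prod.ext_iff.1 hk
      exact Prod.ext (hf x y (Quotient.exact hk) hv) rfl)
  rw [Fintype.card_prod, ← Nat.card_eq_fintype_card (α := Quotient _)] at h2
  refine ⟨S', h1, h2, fun x a hx => ?_⟩
  obtain ⟨⟨y, b⟩, hy, hk, hv⟩ := h3 _ hx
  obtain ⟨rfl, hk⟩ := Prod.ext_iff.1 hk
  exact ⟨y, hy, Quotient.exact hk, hv⟩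

theorem exists_peel_snd (S : Finset (V × V)) (g : V → T)
    (hg : ∀ u v, SameCycle σ u v → g u = g v → u = v) :
    ∃ S' ⊆ S, S.card ≤ S'.card + Fintype.card V * cyc σ ∧
      ∀ x a, (x, a) ∈ S' → ∃ b, (x, b) ∈ S ∧ SameCycle σ b a ∧ g b < g a := by
  classical
  obtain ⟨S', h1, h2, h3⟩ := exists_peel_fst (S.map (Equiv.prodComm V V).toEmbedding) g hg
  refine ⟨S'.map (Equiv.prodComm V V).toEmbedding, ?_, by simpa using h2, ?_⟩
  · intro p hp
    obtain ⟨q, hq, rfl⟩ := Finset.mem_map.1 hp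
    obtain ⟨r, hr, rfl⟩ := Finset.mem_map.1 (h1 hq)
    exact hr
  · intro x a hx
    obtain ⟨⟨b, y⟩, hq, heq⟩ := Finset.mem_map.1 hx
    obtain ⟨rfl, rfl⟩ := Prod.ext_iff.1 heq
    obtain ⟨z, hz, h4, h5⟩ := h3 _ _ hq
    obtain ⟨⟨r, r'⟩, hr, heq⟩ := Finset.mem_map.1 hz
    obtain ⟨rfl, rfl⟩ := Prod.ext_iff.1 heq
    exact ⟨_, hr, h4, h5⟩

theorem exists_peel_both (S : Finset (V × V)) (f : V → T) (g : V → T')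
    (hf : ∀ u v, SameCycle σ u v → f u = f v → u = v)
    (hg : ∀ u v, SameCycle σ u v → g u = g v → u = v) :
    ∃ S' ⊆ S, S.card ≤ S'.card + 2 * (Fintype.card V * cyc σ) ∧
      ∀ p ∈ S', ∃ q ∈ S, SameCycle σ q.1 p.1 ∧ SameCycle σ q.2 p.2 ∧
        f q.1 < f p.1 ∧ g q.2 < g p.2 := by
  obtain ⟨S₁, h1, h2, h3⟩ := exists_peel_snd S g hg
  obtain ⟨S₂, k1, k2, k3⟩ := exists_peel_fst S₁ f hf
  refine ⟨S₂, k1.trans h1, by omega, ?_⟩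
  rintro ⟨x, a⟩ hp
  obtain ⟨y, hy, hyx, hlt⟩ := k3 x a hp
  obtain ⟨b, hb, hba, hlt'⟩ := h3 y a hy
  exact ⟨(y, b), hb, hyx, hba, hlt, hlt'⟩

/-- A large set of pairs contains a long chain within two fixed cycles. -/
theorem exists_chain (S : Finset (V × V)) (f : V → T) (g : V → T')
    (hf : ∀ u v, SameCycle σ u v → f u = f v → u = v)
    (hg : ∀ u v, SameCycle σ u v → g u = g v → u = v) (m : ℕ)
    (hS : m * (2 * (Fintype.card V * cyc σ)) < S.card) :
    ∃ c : ℕ → V × V, (∀ i ≤ m, c i ∈ S) ∧ ∀ i < m, SameCycle σ (c i).1 (c (i + 1)).1 ∧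
      SameCycle σ (c i).2 (c (i + 1)).2 ∧ f (c i).1 < f (c (i + 1)).1 ∧
        g (c i).2 < g (c (i + 1)).2 := by
  classical
  -- After `m` rounds, each surviving pair is the top of a chain with `m + 1` entries.
  suffices H : ∃ S' ⊆ S, S.card ≤ S'.card + m * (2 * (Fintype.card V * cyc σ)) ∧ ∀ p ∈ S',
      ∃ c : ℕ → V × V, c m = p ∧ (∀ i ≤ m, c i ∈ S) ∧ ∀ i < m,
        SameCycle σ (c i).1 (c (i + 1)).1 ∧ SameCycle σ (c i).2 (c (i + 1)).2 ∧
        f (c i).1 < f (c (i + 1)).1 ∧ g (c i).2 < g (c (i + 1)).2 by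
    obtain ⟨S', -, h1, h2⟩ := H
    obtain ⟨p, hp⟩ : S'.Nonempty := Finset.card_pos.1 (by omega)
    obtain ⟨c, -, hc⟩ := h2 p hp
    exact ⟨c, hc⟩
  clear hS
  induction m with
  | zero => exact ⟨S, subset_rfl, by omega, fun p hp => ⟨fun _ => p, rfl, by simpa using hp, by simp⟩⟩
  | succ m ih =>
    obtain ⟨S₁, h1, h2, h3⟩ := ih
    obtain ⟨S₂, k1, k2, k3⟩ := exists_peel_both S₁ f g hf hg
    refine ⟨S₂, k1.trans h1, by rw [add_mul, one_mul]; omega, fun p hp => ?_⟩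
    obtain ⟨q, hq, hqp⟩ := k3 p hp
    obtain ⟨c, hcm, hcS, hc⟩ := h3 q hq
    refine ⟨fun i => if i ≤ m then c i else p, by simp, fun i hi => ?_, fun i hi => ?_⟩
    · by_cases him : i ≤ m
      · simpa [him] using hcS i him
      · simpa [him] using h1 (k1 hp)
    · by_cases him : i < m
      · simpa [him, him.le, Nat.succ_le_of_lt him] using hc i him
      · obtain rfl : i = m := by omega
        simpa [hcm] using hqp

end Peeling

/-! ### Few implanted 4-cycles when no gain is possible -/

section Counting

open Equiv Equiv.Perm

variable {V : Type*} {G F : SimpleGraph V} {σ : Perm V}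

/-- The separation properties of three entries of a chain of positions. -/
theorem exists_separated {pos : V → ℕ} (hp : IsPosition σ pos) {x : ℕ → V}
    (hs : ∀ i < 5, SameCycle σ (x i) (x (i + 1))) (hlt : ∀ i < 5, pos (x i) < pos (x (i + 1))) :
    SameCycle σ (x 3) (x 5) ∧ SameCycle σ (x 3) (x 1) ∧
      pos (x 1) < pos (x 3) ∧ pos (x 3) < pos (x 5) ∧
      σ (x 3) ≠ x 5 ∧ σ (x 5) ≠ x 3 ∧ σ (x 3) ≠ x 1 ∧ σ (x 1) ≠ x 3 ∧ σ (x 5) ≠ x 1 ∧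
      σ (x 1) ≠ x 5 := by
  have l0 := hlt 0 (by norm_num)
  have l1 := hlt 1 (by norm_num)
  have l2 := hlt 2 (by norm_num)
  have l3 := hlt 3 (by norm_num)
  have l4 := hlt 4 (by norm_num)
  have s1 := hs 1 (by norm_num)
  have s2 := hs 2 (by norm_num)
  have s3 := hs 3 (by norm_num)
  have s4 := hs 4 (by norm_num)
  norm_num at l0 l1 l2 l3 l4 s1 s2 s3 s4
  -- Entries 1, 3, 5 are used: entries 2 and 4 keep them from being consecutive, and entry 0 makes
  -- their positions positive, so that no wrap-around step reaches them.
  exact ⟨s3.trans s4, (s1.trans s2).symm, by omega, by omega,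
    hp.apply_ne_of_between s3 l3 l4, hp.apply_ne_of_lt (by omega) (by omega),
    hp.apply_ne_of_lt (by omega) (by omega), hp.apply_ne_of_between s1 l1 l2,
    hp.apply_ne_of_lt (by omega) (by omega), hp.apply_ne_of_between s1 l1 (by omega)⟩

variable [Fintype V]

/-- A parallel pair inside one cycle would split it at once, so all pairs join distinct cycles. In a
chain increasing in the first and decreasing in the second coordinate, switching the pairs 3 and 5
leaves pair 1 on a common cycle. -/
theorem card_parallel_le (hF : IsTwoFactor G F) (hσ : Orients σ F) (hG : ¬ Improvable G F)
    (S : Finset (V × V)) (hS : ∀ x a, (x, a) ∈ S → x ≠ a ∧ G.Adj x (σ a) ∧ G.Adj a (σ x) ∧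
      ¬ F.Adj x (σ a) ∧ ¬ F.Adj a (σ x)) :
    S.card ≤ 10 * (Fintype.card V * cyc σ) := by
  classical
  by_contra! hcon
  obtain ⟨pos, hp⟩ := exists_isPosition σ
  obtain ⟨c, hcS, hc⟩ := exists_chain S pos (fun v => OrderDual.toDual (pos v)) hp.inj
    (fun u v h h' => hp.inj u v h (OrderDual.toDual.injective h')) 5 (by omega)
  obtain ⟨x₃₅, x₃₁, p₁₃, p₃₅, e1, e2, e3, e4, e5, e6⟩ := exists_separated hp
    (x := fun i => (c i).1) (fun i hi => (hc i hi).1) (fun i hi => (hc i hi).2.2.1)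
  have hmem := fun i hi => hS (c i).1 (c i).2 (hcS i hi)
  obtain ⟨y1, y2, y3, y4⟩ :
      SameCycle σ (c 3).2 (c 5).2 ∧ SameCycle σ (c 3).2 (c 1).2 ∧
      pos (c 3).2 < pos (c 1).2 ∧ pos (c 5).2 < pos (c 3).2 := by
    obtain ⟨-, s1, -, l1⟩ := hc 1 (by norm_num)
    obtain ⟨-, s2, -, l2⟩ := hc 2 (by norm_num)
    obtain ⟨-, s3, -, l3⟩ := hc 3 (by norm_num)
    obtain ⟨-, s4, -, l4⟩ := hc 4 (by norm_num)
    rw [OrderDual.toDual_lt_toDual] at l1 l2 l3 l4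
    norm_num at l1 l2 l3 l4 s1 s2 s3 s4
    exact ⟨s3.trans s4, (s1.trans s2).symm, by omega, by omega⟩
  obtain ⟨-, h1, h1', -, -⟩ := hmem 1 (by norm_num)
  obtain ⟨h3ne, h3, h3', n3, n3'⟩ := hmem 3 (by norm_num)
  obtain ⟨-, h5, h5', -, -⟩ := hmem 5 (by norm_num)
  generalize (c 1).1 = x₁, (c 3).1 = x₃, (c 5).1 = x₅, (c 1).2 = a₁, (c 3).2 = a₃,
    (c 5).2 = a₅ at *
  have hd : ¬ SameCycle σ x₃ a₃ := fun h =>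
    hG (improvable_of_parallel hF hσ h3ne h h3 h3' n3 n3')
  have hne : ∀ u v, SameCycle σ x₃ u → SameCycle σ a₃ v → u ≠ v := fun u v hu hv h =>
    hd (hu.trans (h ▸ hv.symm))
  have neq : ∀ {u v : V}, pos u < pos v → u ≠ v := by
    rintro u v h rfl
    exact lt_irrefl _ h
  refine hG (improvable_of_three_pairs hF hσ hd x₃₅ x₃₁ y1 y2 h3 h3' h5 h5' h1 h1'
    (neq p₃₅) (neq p₁₃).symm (neq (p₁₃.trans p₃₅)).symm (neq y4).symm (neq y3)
    (neq (y4.trans y3)) e1 e2 e3 e4 e5 e6 ?_)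
  have hτ : ∀ w, w ≠ x₃ → w ≠ a₃ → w ≠ x₅ → w ≠ a₅ →
      SameCycle (σ * swap x₃ a₃ * swap x₅ a₅) w (σ w) := by
    intro w h h' h'' h'''
    have : (σ * swap x₃ a₃ * swap x₅ a₅) w = σ w := by
      rw [mul_swap_apply_of_ne h'' h''', mul_swap_apply_of_ne h h']
    rw [← this, sameCycle_apply_right]
  -- The surviving route is `x₁` to `x₃`, across to `σ a₃`, on to `a₁`; it avoids `x₅` and `a₅`.
  have k1 : SameCycle (σ * swap x₃ a₃ * swap x₅ a₅) x₁ x₃ :=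
    hp.sameCycle x₃₁.symm p₁₃.le fun w hw hw1 hw2 => by
      have hw' := x₃₁.trans hw
      exact hτ w (neq hw2) (hne _ _ hw' (SameCycle.refl _ _)) (neq (hw2.trans p₃₅))
        (hne _ _ hw' y1)
  have k2 : SameCycle (σ * swap x₃ a₃ * swap x₅ a₅) x₃ (σ a₃) := by
    have : (σ * swap x₃ a₃ * swap x₅ a₅) x₃ = σ a₃ := by
      rw [mul_swap_apply_of_ne (neq p₃₅) (hne _ _ (SameCycle.refl _ _) y1), mul_swap_apply_left]
    rw [← this, sameCycle_apply_right]
  have k3 : SameCycle (σ * swap x₃ a₃ * swap x₅ a₅) (σ a₃) a₁ := by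
    obtain ⟨st1, st2⟩ := hp.step a₃ a₁ y2 y3
    refine hp.sameCycle (sameCycle_apply_left.2 y2) st2 fun w hw hw1 hw2 => ?_
    have hw' : SameCycle σ a₃ w := sameCycle_apply_left.1 hw
    exact hτ w (hne _ _ (SameCycle.refl _ _) hw').symm (neq (st1.trans_le hw1)).symm
      (hne _ _ x₃₅ hw').symm (neq (y4.trans (st1.trans_le hw1))).symm
  exact (k1.trans k2).trans k3

/-- Traversing the cycle of `a₃` backwards makes the pairs parallel, with `σ a` in the role of `a`;
the reversal is why the chain now increases in both coordinates. -/
theorem card_antiparallel_of_not_sameCycle_le (hF : IsTwoFactor G F) (hσ : Orients σ F)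
    (hG : ¬ Improvable G F) (S : Finset (V × V)) (hS : ∀ x a, (x, a) ∈ S → ¬ SameCycle σ x a ∧
      G.Adj x a ∧ G.Adj (σ x) (σ a)) :
    S.card ≤ 10 * (Fintype.card V * cyc σ) := by
  classical
  by_contra! hcon
  obtain ⟨pos, hp⟩ := exists_isPosition σ
  obtain ⟨c, hcS, hc⟩ := exists_chain S pos pos hp.inj hp.inj 5 (by omega)
  obtain ⟨x₃₅, x₃₁, p₁₃, p₃₅, e1, e2, e3, e4, e5, e6⟩ := exists_separated hp
    (x := fun i => (c i).1) (fun i hi => (hc i hi).1) (fun i hi => (hc i hi).2.2.1)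
  obtain ⟨y1, y2, y3, y4, -⟩ := exists_separated hp
    (x := fun i => (c i).2) (fun i hi => (hc i hi).2.1) (fun i hi => (hc i hi).2.2.2)
  have hmem := fun i hi => hS (c i).1 (c i).2 (hcS i hi)
  obtain ⟨-, h1, h1'⟩ := hmem 1 (by norm_num)
  obtain ⟨hd, h3, h3'⟩ := hmem 3 (by norm_num)
  obtain ⟨-, h5, h5'⟩ := hmem 5 (by norm_num)
  generalize (c 1).1 = x₁, (c 3).1 = x₃, (c 5).1 = x₅, (c 1).2 = a₁, (c 3).2 = a₃,
    (c 5).2 = a₅ at *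
  have hne : ∀ u v, SameCycle σ x₃ u → SameCycle σ a₃ v → u ≠ v := fun u v hu hv h =>
    hd (hu.trans (h ▸ hv.symm))
  have neq : ∀ {u v : V}, pos u < pos v → u ≠ v := by
    rintro u v h rfl
    exact lt_irrefl _ h
  have rx : ∀ {u}, SameCycle σ x₃ u → revCycle σ a₃ u = σ u := fun h =>
    revCycle_apply_of_not fun h' => hd (h.trans h'.symm)
  have ra : ∀ {u}, SameCycle σ a₃ u → revCycle σ a₃ (σ u) = u := revCycle_apply_of_sameCycle
  have sa : ∀ {u}, SameCycle σ a₃ u → SameCycle σ a₃ (σ u) := fun h => sameCycle_apply_right.2 h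
  have refx := SameCycle.refl σ x₃
  have refa := SameCycle.refl σ a₃
  refine hG (improvable_of_three_pairs hF (hσ.revCycle a₃) (x₁ := x₃) (x₂ := x₅) (x₃ := x₁)
    (b₁ := σ a₃) (b₂ := σ a₅) (b₃ := σ a₁)
    (fun h => hd (sameCycle_apply_right.1 (sameCycle_revCycle.1 h)))
    (sameCycle_revCycle.2 x₃₅) (sameCycle_revCycle.2 x₃₁)
    (sameCycle_revCycle.2 (sameCycle_apply_left.2 (sa y1)))
    (sameCycle_revCycle.2 (sameCycle_apply_left.2 (sa y2)))
    (by rw [ra refa]; exact h3) (by rw [rx refx]; exact h3'.symm)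
    (by rw [ra y1]; exact h5) (by rw [rx x₃₅]; exact h5'.symm)
    (by rw [ra y2]; exact h1) (by rw [rx x₃₁]; exact h1'.symm)
    (neq p₃₅) (neq p₁₃).symm (neq (p₁₃.trans p₃₅)).symm
    (σ.injective.ne (neq y4)) (σ.injective.ne (neq y3).symm)
    (σ.injective.ne (neq (y3.trans y4)).symm)
    (by rwa [rx refx]) (by rwa [rx x₃₅]) (by rwa [rx refx]) (by rwa [rx x₃₁]) (by rwa [rx x₃₅])
    (by rwa [rx x₃₁]) ?_)
  have hτ : ∀ w, w ≠ x₃ → w ≠ σ a₃ → w ≠ x₅ → w ≠ σ a₅ →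
      (revCycle σ a₃ * swap x₃ (σ a₃) * swap x₅ (σ a₅)) w = revCycle σ a₃ w := by
    intro w h h' h'' h'''
    rw [mul_swap_apply_of_ne h'' h''', mul_swap_apply_of_ne h h']
  have k1 : SameCycle (revCycle σ a₃ * swap x₃ (σ a₃) * swap x₅ (σ a₅)) x₁ x₃ :=
    hp.sameCycle x₃₁.symm p₁₃.le fun w hw hw1 hw2 => by
      have hw' := x₃₁.trans hw
      rw [← rx hw', ← hτ w (neq hw2) (hne _ _ hw' (sa refa)) (neq (hw2.trans p₃₅))
        (hne _ _ hw' (sa y1)), sameCycle_apply_right]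
  have k2 : SameCycle (revCycle σ a₃ * swap x₃ (σ a₃) * swap x₅ (σ a₅)) x₃ a₃ := by
    have : (revCycle σ a₃ * swap x₃ (σ a₃) * swap x₅ (σ a₅)) x₃ = a₃ := by
      rw [mul_swap_apply_of_ne (neq p₃₅) (hne _ _ refx (sa y1)), mul_swap_apply_left, ra refa]
    conv_rhs => rw [← this]
    rw [sameCycle_apply_right]
  have k3 : SameCycle (revCycle σ a₃ * swap x₃ (σ a₃) * swap x₅ (σ a₅)) (σ a₁) a₃ := by
    obtain ⟨st1, st2⟩ := hp.step a₁ a₃ y2.symm y3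
    refine hp.sameCycle (sameCycle_apply_left.2 y2.symm) st2 fun w hw hw1 hw2 => ?_
    have hw' : SameCycle σ a₃ w := y2.trans (sameCycle_apply_left.1 hw)
    have : (revCycle σ a₃ * swap x₃ (σ a₃) * swap x₅ (σ a₅)) (σ w) = w := by
      rw [hτ (σ w) (hne _ _ refx (sa hw')).symm (σ.injective.ne (neq hw2))
        (hne _ _ x₃₅ (sa hw')).symm (σ.injective.ne (neq (hw2.trans y4))), ra hw']
    conv_lhs => rw [← this]
    rw [sameCycle_apply_left]
  exact (k1.trans k2).trans k3.symm

/-- Four rounds of discarding, each costing at most `Fintype.card V * cyc σ` pairs, leave a pair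
that yields two crossing chords. -/
theorem card_antiparallel_of_lt_le (hF : IsTwoFactor G F) (hσ : Orients σ F)
    (hG : ¬ Improvable G F) {pos : V → ℕ} (hp : IsPosition σ pos) (S : Finset (V × V))
    (hS : ∀ x a, (x, a) ∈ S → SameCycle σ x a ∧ pos x < pos a ∧
      G.Adj x a ∧ G.Adj (σ x) (σ a) ∧ ¬ F.Adj x a ∧ ¬ F.Adj (σ x) (σ a)) :
    S.card ≤ 4 * (Fintype.card V * cyc σ) := by
  classical
  by_contra! hcon
  have hinj : ∀ u v, SameCycle σ u v → OrderDual.toDual (pos u) = OrderDual.toDual (pos v) →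
      u = v := fun u v h h' => hp.inj u v h (OrderDual.toDual.injective h')
  obtain ⟨S₁, b1, c1, d1⟩ := exists_peel_snd S (fun v => OrderDual.toDual (pos v)) hinj
  obtain ⟨S₂, b2, c2, d2⟩ := exists_peel_fst S₁ pos hp.inj
  obtain ⟨S₃, b3, c3, d3⟩ := exists_peel_fst S₂ pos hp.inj
  obtain ⟨S₄, b4, c4, d4⟩ := exists_peel_fst S₃ (fun v => OrderDual.toDual (pos v)) hinj
  -- The positions satisfy `x < m < x' < y < a < a'`, so the chords `x a` and `x' a'` cross; `m` and
  -- `y` only separate, giving `x' ≠ σ x` and `σ x' ≠ a`.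
  obtain ⟨⟨x', a⟩, hx'⟩ : S₄.Nonempty := Finset.card_pos.1 (by omega)
  obtain ⟨y, hy, yx', lyx'⟩ := d4 _ _ hx'
  obtain ⟨m, hm, mx', lmx'⟩ := d3 _ _ (b4 hx')
  obtain ⟨x, hx, xm, lxm⟩ := d2 _ _ hm
  obtain ⟨a', ha', a'a, laa'⟩ := d1 _ _ (b2 (b3 (b4 hx')))
  rw [OrderDual.toDual_lt_toDual] at lyx' laa'
  obtain ⟨-, lya, -⟩ := hS _ _ (b1 (b2 (b3 hy)))
  obtain ⟨hs, lxa, h1, h2, n1, n2⟩ := hS _ _ (b1 hx)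
  obtain ⟨-, -, h1', h2', -, -⟩ := hS _ _ ha'
  have neq : ∀ {u v : V}, pos u < pos v → u ≠ v := by
    rintro u v h rfl
    exact lt_irrefl _ h
  have hτ : ∀ w, w ≠ x → w ≠ a → SameCycle (σ * swap x a) w (σ w) := by
    intro w h h'
    rw [← mul_swap_apply_of_ne h h', sameCycle_apply_right]
  obtain ⟨st1, st2⟩ := hp.step a a' a'a.symm laa'
  have x'a : SameCycle σ x' a := ((xm.trans mx').symm).trans hs
  refine hG (improvable_of_crossing hF hσ (neq lxa) hs h1 h2 n1 n2 (x' := x') (a' := a') ?_ ?_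
    h1' h2' (neq (lyx'.trans lya)) (neq (lxa.trans laa')).symm
    (hp.apply_ne_of_between xm lxm lmx').symm (hp.apply_ne_of_between yx'.symm lyx' lya))
  · refine SameCycle.symm (hp.sameCycle x'a (lyx'.trans lya).le fun w _ hw1 hw2 => ?_)
    exact hτ w (neq ((lxm.trans lmx').trans_le hw1)).symm (neq hw2)
  · rw [← sameCycle_apply_left, mul_swap_apply_left]
    refine hp.sameCycle (sameCycle_apply_left.2 a'a.symm) st2 fun w _ hw1 _ => ?_
    have := st1.trans_le hw1
    exact hτ w (neq (lxa.trans this)).symm (neq this).symm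

theorem card_antiparallel_le (hF : IsTwoFactor G F) (hσ : Orients σ F)
    (hG : ¬ Improvable G F) (S : Finset (V × V)) (hS : ∀ x a, (x, a) ∈ S →
      G.Adj x a ∧ G.Adj (σ x) (σ a) ∧ ¬ F.Adj x a ∧ ¬ F.Adj (σ x) (σ a)) :
    S.card ≤ 18 * (Fintype.card V * cyc σ) := by
  classical
  obtain ⟨pos, hp⟩ := exists_isPosition σ
  have c1 := card_antiparallel_of_not_sameCycle_le hF hσ hG
    (S.filter fun p => ¬ SameCycle σ p.1 p.2) (fun x a h => by
      obtain ⟨h, h'⟩ := Finset.mem_filter.1 h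
      exact ⟨h', (hS x a h).1, (hS x a h).2.1⟩)
  have c2 := card_antiparallel_of_lt_le hF hσ hG hp
    (S.filter fun p => SameCycle σ p.1 p.2 ∧ pos p.1 < pos p.2) (fun x a h => by
      obtain ⟨h, h', h''⟩ := Finset.mem_filter.1 h
      exact ⟨h', h'', hS x a h⟩)
  have c3 := card_antiparallel_of_lt_le hF hσ hG hp
    ((S.filter fun p => SameCycle σ p.1 p.2 ∧ pos p.2 < pos p.1).map
      (Equiv.prodComm V V).toEmbedding) (fun x a h => by
      obtain ⟨⟨b, y⟩, hby, heq⟩ := Finset.mem_map.1 h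
      obtain ⟨rfl, rfl⟩ := Prod.ext_iff.1 heq
      obtain ⟨hm, h', h''⟩ := Finset.mem_filter.1 hby
      obtain ⟨g1, g2, g3, g4⟩ := hS _ _ hm
      exact ⟨h'.symm, h'', g1.symm, g2.symm, fun h => g3 h.symm, fun h => g4 h.symm⟩)
  rw [Finset.card_map] at c3
  -- Distinct cycles contribute 10, and each of the two orders within one cycle contributes 4.
  have hsub : S ⊆ (S.filter fun p => ¬ SameCycle σ p.1 p.2) ∪
      ((S.filter fun p => SameCycle σ p.1 p.2 ∧ pos p.1 < pos p.2) ∪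
        (S.filter fun p => SameCycle σ p.1 p.2 ∧ pos p.2 < pos p.1)) := by
    rintro ⟨x, a⟩ hx
    simp only [Finset.mem_union, Finset.mem_filter, hx, true_and]
    by_cases hs : SameCycle σ x a
    · have hne : pos x ≠ pos a := fun h => (hS x a hx).1.ne (hp.inj x a hs h)
      rcases lt_or_gt_of_ne hne with h | h
      · exact Or.inr (Or.inl ⟨hs, h⟩)
      · exact Or.inr (Or.inr ⟨hs, h⟩)
    · exact Or.inl hs
  have d1 := Finset.card_le_card hsub
  have d2 := Finset.card_union_le (S.filter fun p => ¬ SameCycle σ p.1 p.2)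
      ((S.filter fun p => SameCycle σ p.1 p.2 ∧ pos p.1 < pos p.2) ∪
        (S.filter fun p => SameCycle σ p.1 p.2 ∧ pos p.2 < pos p.1))
  have d3 := Finset.card_union_le (S.filter fun p => SameCycle σ p.1 p.2 ∧ pos p.1 < pos p.2)
        (S.filter fun p => SameCycle σ p.1 p.2 ∧ pos p.2 < pos p.1)
  omega

end Counting

/-! ### From the auxiliary graph to repeated gains -/

section Quadruples

open Equiv Equiv.Perm

/-- The 4-cycle `xyzw` of `G` has exactly the two edges `xy`, `zw` in `F`. -/
def IsQuad {V : Type*} (G F : SimpleGraph V) (p : V × V × V × V) : Prop :=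
  p.1 ≠ p.2.2.1 ∧ p.2.1 ≠ p.2.2.2 ∧ F.Adj p.1 p.2.1 ∧ F.Adj p.2.2.1 p.2.2.2 ∧
    G.Adj p.2.1 p.2.2.1 ∧ G.Adj p.2.2.2 p.1 ∧ ¬ F.Adj p.2.1 p.2.2.1 ∧ ¬ F.Adj p.2.2.2 p.1

open Classical in
/-- The 4-cycles of `G` that are implanted in `F`, as quadruples of vertices. -/
noncomputable def quads {V : Type*} [Fintype V] (G F : SimpleGraph V) : Finset (V × V × V × V) :=
  Finset.univ.filter (IsQuad G F)

/-- Non-incidence forces the second edge to be the one opposite to the first. -/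
theorem isQuad_of_c4 {V : Type*} {G F : SimpleGraph V} {x y z w : V} {e e' : Sym2 V} (hxz : x ≠ z)
    (hyw : y ≠ w) (hyz : G.Adj y z) (hwx : G.Adj w x) (hn : NonIncident e e')
    (hD : ({s(x, y), s(y, z), s(z, w), s(w, x)} : Set (Sym2 V)) ∩ F.edgeSet = {e, e'})
    (he : e = s(x, y)) : IsQuad G F (x, y, z, w) ∧ e' = s(z, w) := by
  have hmem : ∀ d, d ∈ ({s(x, y), s(y, z), s(z, w), s(w, x)} : Set (Sym2 V)) ∩ F.edgeSet ↔
      d = e ∨ d = e' := fun d => by rw [hD]; rfl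
  have h1 := (hmem e).2 (Or.inl rfl)
  have h2 := (hmem e').2 (Or.inr rfl)
  have he' : e' = s(z, w) := by
    rcases h2.1 with h | h | h | h
    · exact absurd ⟨he ▸ Sym2.mem_mk_left x y, h ▸ Sym2.mem_mk_left x y⟩ (hn x)
    · exact absurd ⟨he ▸ Sym2.mem_mk_right x y, h ▸ Sym2.mem_mk_left y z⟩ (hn y)
    · exact h
    · exact absurd ⟨he ▸ Sym2.mem_mk_left x y, h ▸ Sym2.mem_mk_right w x⟩ (hn x)
  refine ⟨⟨hxz, hyw, ?_, ?_, hyz, hwx, fun h => ?_, fun h => ?_⟩, he'⟩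
  · have h3 := h1.2
    rwa [he] at h3
  · have h3 := h2.2
    rwa [he'] at h3
  · rcases (hmem s(y, z)).1 ⟨Or.inr (Or.inl rfl), h⟩ with h3 | h3
    · rw [he, Sym2.eq_iff] at h3
      have := hyz.ne
      grind
    · rw [he', Sym2.eq_iff] at h3
      have := hyz.ne
      grind
  · rcases (hmem s(w, x)).1 ⟨Or.inr (Or.inr (Or.inr rfl)), h⟩ with h3 | h3
    · rw [he, Sym2.eq_iff] at h3
      have := hwx.ne
      grind
    · rw [he', Sym2.eq_iff] at h3
      have := hwx.ne
      grind

theorem ncard_auxGraph_le {V : Type*} [Fintype V] (G F : SimpleGraph V) :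
    (auxGraph G F).edgeSet.ncard ≤ (quads G F).card := by
  classical
  let g : V × V × V × V → Sym2 (Sym2 V) := fun p => s(s(p.1, p.2.1), s(p.2.2.1, p.2.2.2))
  have hinj : Function.Injective (Sym2.map (Subtype.val : F.edgeSet → Sym2 V)) :=
    Sym2.map.injective Subtype.val_injective
  rw [← Set.ncard_image_of_injective _ hinj]
  refine le_trans (Set.ncard_le_ncard (t := ((quads G F).image g : Finset _)) ?_
    (Finset.finite_toSet _)) ((Set.ncard_coe_finset _).trans_le Finset.card_image_le)
  rintro _ ⟨E, hE, rfl⟩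
  induction E using Sym2.ind with | _ e e' => ?_
  obtain ⟨-, hn, D, ⟨x, y, z, w, hxz, hyw, hxy, hyz, hzw, hwx, rfl⟩, hD⟩ := hE
  rw [Finset.mem_coe, Finset.mem_image]
  have key : ∀ x y z w : V, x ≠ z → y ≠ w → G.Adj y z → G.Adj w x →
      ({s(x, y), s(y, z), s(z, w), s(w, x)} : Set (Sym2 V)) ∩ F.edgeSet = {e.1, e'.1} →
      e.1 = s(x, y) → ∃ p ∈ quads G F, g p = Sym2.map Subtype.val s(e, e') := by
    intro x y z w hxz hyw hyz hwx hD he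
    obtain ⟨h1, h2⟩ := isQuad_of_c4 hxz hyw hyz hwx hn hD he
    refine ⟨(x, y, z, w), Finset.mem_filter.2 ⟨Finset.mem_univ _, h1⟩, ?_⟩
    rw [Sym2.map_mk, he, h2]
  -- The 4-cycle is rotated until `e` is its first listed edge.
  have rot : ∀ x y z w : V, ({s(x, y), s(y, z), s(z, w), s(w, x)} : Set (Sym2 V)) =
      {s(y, z), s(z, w), s(w, x), s(x, y)} := by
    intro x y z w
    ext d
    simp only [Set.mem_insert_iff, Set.mem_singleton_iff]
    tauto
  have hmem : e.1 ∈ ({s(x, y), s(y, z), s(z, w), s(w, x)} : Set (Sym2 V)) := by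
    have : e.1 ∈ ({e.1, e'.1} : Set (Sym2 V)) := Or.inl rfl
    rw [← hD] at this
    exact this.1
  rcases hmem with h | h | h | h
  · exact key x y z w hxz hyw hyz hwx hD h
  · rw [rot] at hD
    exact key y z w x hyw hxz.symm hzw hxy hD h
  · rw [rot, rot] at hD
    exact key z w x y hxz.symm hyw.symm hwx hyz hD h
  · rw [rot, rot, rot] at hD
    exact key w x y z hyw.symm hxz hxy hzw hD h

variable {V : Type*} [Fintype V] {G F : SimpleGraph V}

/-- Each of the two `F`-edges of a quadruple is listed along or against `σ`. Two of the four cases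
are parallel and two antiparallel, so the constant is 2 · 10 + 2 · 18. -/
theorem card_quads_le (hF : IsTwoFactor G F) (hG : ¬ Improvable G F) :
    (quads G F).card ≤ 56 * (Fintype.card V * numCycles F) := by
  classical
  obtain ⟨σ, hσ⟩ := exists_orients hF.2
  let A : Finset (V × V) := Finset.univ.filter fun p => p.1 ≠ p.2 ∧ G.Adj p.1 (σ p.2) ∧
    G.Adj p.2 (σ p.1) ∧ ¬ F.Adj p.1 (σ p.2) ∧ ¬ F.Adj p.2 (σ p.1)
  let B : Finset (V × V) := Finset.univ.filter fun p => G.Adj p.1 p.2 ∧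
    G.Adj (σ p.1) (σ p.2) ∧ ¬ F.Adj p.1 p.2 ∧ ¬ F.Adj (σ p.1) (σ p.2)
  have hA : A.card ≤ 10 * (Fintype.card V * cyc σ) :=
    card_parallel_le hF hσ hG A fun x a h => (Finset.mem_filter.1 h).2
  have hB : B.card ≤ 18 * (Fintype.card V * cyc σ) :=
    card_antiparallel_le hF hσ hG B fun x a h => (Finset.mem_filter.1 h).2
  have hsub : quads G F ⊆ (A.image fun p => (p.1, σ p.1, p.2, σ p.2)) ∪
      (A.image fun p => (σ p.1, p.1, σ p.2, p.2)) ∪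
      ((B.image fun p => (p.1, σ p.1, σ p.2, p.2)) ∪
        (B.image fun p => (σ p.1, p.1, p.2, σ p.2))) := by
    rintro ⟨x, y, z, w⟩ hp
    obtain ⟨hxz, hyw, hxy, hzw, hyz, hwx, nyz, nwx⟩ := (Finset.mem_filter.1 hp).2
    dsimp only at hxz hyw hxy hzw hyz hwx nyz nwx
    simp only [Finset.mem_union, Finset.mem_image, A, B, Finset.mem_filter, Finset.mem_univ,
      true_and, Prod.exists]
    rcases (hσ x y).1 hxy with rfl | rfl <;> rcases (hσ z w).1 hzw with rfl | rfl
    · exact Or.inl (Or.inl ⟨x, z, ⟨hxz, hwx.symm, hyz.symm, fun h => nwx h.symm,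
        fun h => nyz h.symm⟩, rfl⟩)
    · exact Or.inr (Or.inl ⟨x, w, ⟨hwx.symm, hyz, fun h => nwx h.symm, nyz⟩, rfl⟩)
    · exact Or.inr (Or.inr ⟨y, z, ⟨hyz, hwx.symm, nyz, fun h => nwx h.symm⟩, rfl⟩)
    · exact Or.inl (Or.inr ⟨y, w, ⟨hyw, hyz, hwx, nyz, nwx⟩, rfl⟩)
  have h0 := (Finset.card_le_card hsub).trans (Finset.card_union_le _ _)
  have h1 := (Finset.card_union_le (A.image fun p => (p.1, σ p.1, p.2, σ p.2))
    (A.image fun p => (σ p.1, p.1, σ p.2, p.2))).trans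
      (add_le_add Finset.card_image_le Finset.card_image_le)
  have h2 := (Finset.card_union_le (B.image fun p => (p.1, σ p.1, σ p.2, p.2))
    (B.image fun p => (σ p.1, p.1, p.2, σ p.2))).trans
      (add_le_add Finset.card_image_le Finset.card_image_le)
  rw [hσ.numCycles_eq]
  omega

/-- A lost quadruple has a corner in `U`. That corner, one arbitrary vertex and two binary choices
of `F`-neighbours determine it; the four corners give 4 · 4. -/
theorem card_quads_le_of_agreeOff {F' : SimpleGraph V} (hF : IsTwoFactor G F) {U : Finset V}
    (hU : AgreeOff U F F') :
    (quads G F).card ≤ (quads G F').card + 16 * (Fintype.card V * U.card) := by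
  classical
  obtain ⟨σ, hσ⟩ := exists_orients hF.2
  let τ : Bool → V → V := fun i v => if i then σ v else σ.symm v
  have hτ : ∀ u v, F.Adj u v → ∃ i, τ i u = v := by
    intro u v h
    rcases (hσ u v).1 h with h | h
    · exact ⟨true, h⟩
    · exact ⟨false, (Equiv.symm_apply_eq σ).2 h.symm⟩
  let Z : Finset (V × V × Bool × Bool) := U ×ˢ Finset.univ
  have hZ : Z.card = 4 * (Fintype.card V * U.card) := by
    rw [Finset.card_product, Finset.card_univ, Fintype.card_prod, Fintype.card_prod,
      Fintype.card_bool]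
    ring
  let f₁ : V × V × Bool × Bool → V × V × V × V := fun q =>
    (q.1, τ q.2.2.1 q.1, q.2.1, τ q.2.2.2 q.2.1)
  let f₂ : V × V × Bool × Bool → V × V × V × V := fun q =>
    (τ q.2.2.1 q.1, q.1, q.2.1, τ q.2.2.2 q.2.1)
  let f₃ : V × V × Bool × Bool → V × V × V × V := fun q =>
    (q.2.1, τ q.2.2.2 q.2.1, q.1, τ q.2.2.1 q.1)
  let f₄ : V × V × Bool × Bool → V × V × V × V := fun q =>
    (q.2.1, τ q.2.2.2 q.2.1, τ q.2.2.1 q.1, q.1)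
  have hsub : quads G F ⊆ quads G F' ∪ ((Z.image f₁ ∪ Z.image f₂) ∪ (Z.image f₃ ∪ Z.image f₄)) := by
    rintro ⟨x, y, z, w⟩ hp
    obtain ⟨hxz, hyw, hxy, hzw, hyz, hwx, nyz, nwx⟩ := (Finset.mem_filter.1 hp).2
    dsimp only at hxz hyw hxy hzw hyz hwx nyz nwx
    rw [Finset.mem_union]
    by_cases hx : x ∈ U
    · obtain ⟨i, rfl⟩ := hτ _ _ hxy
      obtain ⟨j, rfl⟩ := hτ _ _ hzw
      exact Or.inr (Finset.mem_union_left _ (Finset.mem_union_left _ (Finset.mem_image.2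
        ⟨(x, z, i, j), Finset.mem_product.2 ⟨hx, Finset.mem_univ _⟩, rfl⟩)))
    by_cases hy : y ∈ U
    · obtain ⟨i, rfl⟩ := hτ _ _ hxy.symm
      obtain ⟨j, rfl⟩ := hτ _ _ hzw
      exact Or.inr (Finset.mem_union_left _ (Finset.mem_union_right _ (Finset.mem_image.2
        ⟨(y, z, i, j), Finset.mem_product.2 ⟨hy, Finset.mem_univ _⟩, rfl⟩)))
    by_cases hz : z ∈ U
    · obtain ⟨i, rfl⟩ := hτ _ _ hzw
      obtain ⟨j, rfl⟩ := hτ _ _ hxy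
      exact Or.inr (Finset.mem_union_right _ (Finset.mem_union_left _ (Finset.mem_image.2
        ⟨(z, x, i, j), Finset.mem_product.2 ⟨hz, Finset.mem_univ _⟩, rfl⟩)))
    by_cases hw : w ∈ U
    · obtain ⟨i, rfl⟩ := hτ _ _ hzw.symm
      obtain ⟨j, rfl⟩ := hτ _ _ hxy
      exact Or.inr (Finset.mem_union_right _ (Finset.mem_union_right _ (Finset.mem_image.2
        ⟨(w, x, i, j), Finset.mem_product.2 ⟨hw, Finset.mem_univ _⟩, rfl⟩)))
    left
    exact Finset.mem_filter.2 ⟨Finset.mem_univ _, hxz, hyw, (hU _ _ hx).2 hxy, (hU _ _ hz).2 hzw,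
      hyz, hwx, fun h => nyz ((hU _ _ hy).1 h), fun h => nwx ((hU _ _ hw).1 h)⟩
  have h0 := (Finset.card_le_card hsub).trans (Finset.card_union_le _ _)
  have h1 := Finset.card_union_le (Z.image f₁ ∪ Z.image f₂) (Z.image f₃ ∪ Z.image f₄)
  have h2 := (Finset.card_union_le (Z.image f₁) (Z.image f₂)).trans
    (add_le_add Finset.card_image_le Finset.card_image_le)
  have h3 := (Finset.card_union_le (Z.image f₃) (Z.image f₄)).trans
    (add_le_add Finset.card_image_le Finset.card_image_le)
  omega

/-- As long as `auxGraph G C` has many edges, the number of cycles can be increased step by step. -/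
theorem exists_twoFactor_add {C : SimpleGraph V} (hC : IsTwoFactor G C) (j : ℕ)
    (hj : 248 * (Fintype.card V * (numCycles C + j)) < (auxGraph G C).edgeSet.ncard) :
    ∃ F : SimpleGraph V, IsTwoFactor G F ∧ numCycles F = numCycles C + j ∧
      Relation.ReflTransGen (IsC4Switch G) C F ∧
      ∃ U : Finset V, U.card ≤ 12 * j ∧ AgreeOff U C F := by
  classical
  induction j with
  | zero => exact ⟨C, hC, rfl, .refl, ∅, by simp, fun _ _ _ => Iff.rfl⟩
  | succ j ih =>
    have hmono : Fintype.card V * (numCycles C + j) ≤ Fintype.card V * (numCycles C + (j + 1)) :=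
      Nat.mul_le_mul_left _ (by omega)
    obtain ⟨F, h1, h2, h3, U, h4, h5⟩ := ih (by omega)
    -- The constant 248 is 56 + 16 · 12: quadruples of a non-improvable `F`, plus those lost since
    -- `C` by changing 12 vertices per gained cycle.
    have h6 : Improvable G F := by
      by_contra hG
      have k1 := card_quads_le h1 hG
      have k2 := card_quads_le_of_agreeOff hC h5
      have k3 := ncard_auxGraph_le G C
      have k4 : Fintype.card V * U.card ≤ Fintype.card V * (12 * (numCycles C + j)) :=
        Nat.mul_le_mul_left _ (by omega)
      rw [mul_left_comm] at k4
      rw [h2] at k1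
      omega
    obtain ⟨F', g1, g2, g3, U', g4, g5⟩ := h6
    refine ⟨F', g1, by omega, h3.trans g2, U ∪ U', ?_, h5.trans g5⟩
    have := Finset.card_union_le U U'
    omega

end Quadruples

/-! ### Choice of the constants -/

theorem mainTheorem3 :
    ∀ δ : ℝ, 0 < δ → δ ≤ 1 →
      ∃ η₀ : ℝ, 0 < η₀ ∧ ∀ η : ℝ, 0 < η → η ≤ η₀ →
        ∃ n₀ : ℕ, ∀ n : ℕ, n₀ ≤ n →
          ∀ (V : Type*) [Fintype V], Fintype.card V = n →
          ∀ (G C : SimpleGraph V) (l k : ℕ),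
            IsTwoFactor G C →
            numCycles C = l →
            1 ≤ l → (l : ℝ) ≤ (n : ℝ) ^ (1 - δ) →
            (n : ℝ) ^ (2 - η) ≤ ((auxGraph G C).edgeSet.ncard : ℝ) →
            l ≤ k → (k : ℝ) ≤ (n : ℝ) ^ (1 - δ) →
              ∃ C' : SimpleGraph V,
                IsTwoFactor G C' ∧ numCycles C' = k ∧
                  Relation.ReflTransGen (IsC4Switch G) C C' := by
  intro δ hδ _
  -- With η ≤ δ/2 the exponents satisfy 1 + (1 - δ) + δ/2 ≤ 2 - η, which leaves a factor n^(δ/2) to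
  -- beat 248.
  refine ⟨δ / 2, half_pos hδ, fun η _ hη => ?_⟩
  have hlim := ((tendsto_rpow_atTop (half_pos hδ)).comp tendsto_natCast_atTop_atTop).eventually
    (Filter.eventually_gt_atTop (248 : ℝ))
  obtain ⟨n₀, hn₀⟩ := Filter.eventually_atTop.1 hlim
  refine ⟨max n₀ 1, fun n hn V _ hV G C l k hC hl _ _ he hlk hk => ?_⟩
  have hn1 : (1 : ℝ) ≤ n := by exact_mod_cast (le_max_right _ _).trans hn
  have hn0 : (0 : ℝ) < n := by linarith
  have hbig : (248 : ℝ) < (n : ℝ) ^ (δ / 2) := hn₀ n ((le_max_left _ _).trans hn)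
  have hpow : (n : ℝ) * (n : ℝ) ^ (1 - δ) * (n : ℝ) ^ (δ / 2) ≤ (n : ℝ) ^ (2 - η) := by
    conv_lhs => rw [← Real.rpow_one_add' hn0.le (by linarith), ← Real.rpow_add hn0]
    exact Real.rpow_le_rpow_of_exponent_le hn1 (by linarith)
  have hlt : (248 : ℝ) * (n * k) < (n : ℝ) ^ (2 - η) := by
    have hp : (0 : ℝ) < n * (n : ℝ) ^ (1 - δ) := mul_pos hn0 (Real.rpow_pos_of_pos hn0 _)
    have h1 : (n : ℝ) * k ≤ n * (n : ℝ) ^ (1 - δ) := mul_le_mul_of_nonneg_left hk hn0.le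
    have h2 := mul_lt_mul_of_pos_left hbig hp
    linarith
  obtain ⟨F, h1, h2, h3, -⟩ := exists_twoFactor_add hC (k - l) (by
    rw [hl, hV, Nat.add_sub_cancel' hlk]
    exact_mod_cast hlt.trans_le he)
  exact ⟨F, h1, by omega, h3⟩
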